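/- Let $\Omega\subset\mathbb R^{n}$ be a bounded open set, let $H=L^2(\Omega)$ (real-valued functions, norm $\|\cdot\|$), let $r>0$, and let $C=C([-r,0];H)$ with the supremum norm $\|\cdot\|_C$. Let $A$ be a densely defined self-adjoint linear operator in $H$ with compact resolvent which is positive in the sense that $\langle Ax,x\rangle\ge 0$ for all $x\in D(A)$, let $e^{-tA}$, $t\ge 0$, be the semigroup generated by $-A$, and let $d\ge 0$. Let $B:H\to H$ be Lipschitz continuous, $\|B(v^1)-B(v^2)\|\le L_B\|v^1-v^2\|$ for all $v^1,v^2\in H$. Let $\Theta^u,\Theta^\ell,\eta:C\to[0,r]$ with $\Theta^\ell(\varphi)\le\Theta^u(\varphi)$ for all $\varphi\in C$, and put $F(\varphi)=B(\varphi(-\eta(\varphi)))$ for $\varphi\in C$. For a function $u$ with values in $H$ write $u_t(\theta)=u(t+\theta)$, $\theta\in[-r,0]$. A mild solution on $[-r,T]$ with initial function $\varphi\in C$ is a function $u\in C([-r,T];H)$ with $u|_{[-r,0]}=\varphi$ and $$u(t)=e^{-tA}\varphi(0)+\int_0^t e^{-(t-s)A}\{F(u_s)-d\,u(s)\}\,ds,\qquad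 t\in[0,T];$$ a global mild solution is a function $u\in C([-r,\infty);H)$ whose restriction to $[-r,T]$ is a mild solution for every $T\geq 0$. Assume: 1. $\Theta^u$ and $\Theta^\ell$ are continuous. 2. There is $L\ge 0$ such that every $\varphi$ in $Z=\{\varphi\in C:\Theta^\ell(\varphi)=0\}$ satisfies $\|\varphi(t)-\varphi(s)\|\le L|t-s|$ for all $t,s\in[-r,0]$. 3. $\eta$ is continuous and satisfies $(\widehat H)$: for all $\varphi,\psi\in C$, if $\psi(\theta)=\varphi(\theta)$ for all $\theta\in[-\Theta^u(\varphi),-\Theta^\ell(\varphi)]$, then $\eta(\psi)=\eta(\varphi)$. 4. $\eta(\varphi)>0$ for all $\varphi\in Z$. 5. There are $\omega>0$ and $L_\eta>0$ such that $|\eta(\varphi)-\eta(\psi)|\le L_\eta\|\varphi-\psi\|_C$ for all $\varphi,\psi\in U_\omega(Z)=\{\chi\in C:\exists\,\nu\in Z,\ \|\chi-\nu\|_C\le\omega\}$. Then for every $\varphi\in C$ there is a unique global mild solution with initial function $\varphi$, and for every $T\ge 0$ there is a unique mild solution on $[-r,T]$ with initial function $\varphi$. Moreover, the evolution operators $S_t:C\to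 C$, $S_t\varphi=u_t$ ($t\ge 0$), where $u$ is the global mild solution with initial function $\varphi$, form a dynamical system on $C$: (i) $S_0=\mathrm{Id}$; (ii) $S_tS_\tau=S_{t+\tau}$ for all $t,\tau\ge 0$; (iii) for every $\varphi\in C$ the map $t\mapsto S_t\varphi$ from $[0,\infty)$ to $C$ is continuous; (iv) for every $t\ge 0$ the map $S_t:C\to C$ is continuous. -/

import Mathlib

open Set MeasureTheory
open scoped NNReal

noncomputable section

namespace DelayParabolic

/-- The real Hilbert space `L²(Ω)`, with respect to Lebesgue measure. -/
abbrev L2 {n : ℕ} (Ω : Set (EuclideanSpace ℝ (Fin n))) : Type :=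
  Lp ℝ 2 (volume.restrict Ω)

section Operator

variable {H : Type*} [NormedAddCommGroup H] [InnerProductSpace ℝ H] [CompleteSpace H]

/-- `A` has compact resolvent: for some real `μ`, the operator `A + μ : D(A) → H` is a bijection
whose inverse `R` is a compact operator on `H`. -/
def HasCompactResolvent (A : H →ₗ.[ℝ] H) : Prop :=
  ∃ (μ : ℝ) (R : H →L[ℝ] H), IsCompactOperator R ∧
    (∀ x : A.domain, R (A x + μ • (x : H)) = x) ∧
    (∀ y : H, ∃ x : A.domain, (x : H) = R y ∧ A x + μ • (x : H) = y)

/-- The eigenspace `ker (A - μ) ⊆ D(A) ⊆ H`. -/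
def eigenspace (A : H →ₗ.[ℝ] H) (μ : ℝ) : Submodule ℝ H :=
  (LinearMap.ker (A.toFun - μ • A.domain.subtype)).map A.domain.subtype

/-- The operator `e^{-tA}`, `t ≥ 0`, of a nonnegative self-adjoint operator `A` with compact
resolvent, by its spectral decomposition `e^{-tA} v = ∑_μ e^{-tμ} P_μ v`, where `P_μ` is the
orthogonal projection onto the eigenspace of `μ`. Only the (countably many) eigenvalues contribute,
and the eigenspaces of a self-adjoint operator are closed, so that taking the closure changes
nothing there. -/
def expNeg (A : H →ₗ.[ℝ] H) (t : ℝ) (v : H) : H :=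
  ∑' μ : ℝ, Real.exp (-(t * μ)) • (eigenspace A μ).topologicalClosure.starProjection v

end Operator

/-- The phase space `C([-r, 0]; H)`; its norm is the supremum norm. -/
abbrev PhaseSpace (r : ℝ≥0) (H : Type*) [NormedAddCommGroup H] : Type _ :=
  C(Icc (-(r : ℝ)) 0, H)

section Delay

variable {H : Type*} [NormedAddCommGroup H] {r : ℝ≥0}

/-- The point `0` of `[-r, 0]`. -/
def zeroPt (r : ℝ≥0) : Icc (-(r : ℝ)) 0 := ⟨0, by simp, le_rfl⟩

/-- The reflection `a ↦ -a` from `[0, r]` to `[-r, 0]`. -/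
def negPt (a : Icc (0 : ℝ) r) : Icc (-(r : ℝ)) 0 :=
  ⟨-(a : ℝ), neg_le_neg a.2.2, neg_nonpos.2 a.2.1⟩

/-- The delay term `F(φ) = B(φ(-η(φ)))`. -/
def delayTerm (B : H → H) (η : PhaseSpace r H → Icc (0 : ℝ) r) (φ : PhaseSpace r H) : H :=
  B (φ (negPt (η φ)))

/-- The segment `w_t ∈ C([-r, 0]; H)`, `w_t(θ) = w(t + θ)`. -/
def history (r : ℝ≥0) (w : C(ℝ, H)) (t : ℝ) : PhaseSpace r H where
  toFun θ := w (t + (θ : ℝ))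
  continuous_toFun := by fun_prop

/-- Constant extension to the left of a function in `C([-r, ∞); H)`; a segment `w_t` with `t ≥ 0`
does not see the extension. -/
def extendIci (u : C(Ici (-(r : ℝ)), H)) : C(ℝ, H) where
  toFun t := u ⟨max (-(r : ℝ)) t, mem_Ici.2 (le_max_left _ _)⟩
  continuous_toFun :=
    u.continuous.comp ((continuous_const.max continuous_id).subtype_mk _)

/-- Constant extension to both sides of a function in `C([-r, T]; H)`; a segment `w_t` with
`0 ≤ t ≤ T` does not see the extension. -/
def extendIcc {T : ℝ≥0} (u : C(Icc (-(r : ℝ)) T, H)) : C(ℝ, H) :=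
  u.IccExtend ((neg_nonpos.2 r.2).trans T.2)

/-- Assumption `(Ĥ)`: `η` ignores the values of `φ` outside `[-Θᵘ(φ), -Θˡ(φ)]`. -/
def IgnoresOutside (Θu Θl η : PhaseSpace r H → Icc (0 : ℝ) r) : Prop :=
  ∀ φ ψ : PhaseSpace r H,
    (∀ θ : Icc (-(r : ℝ)) 0,
      (θ : ℝ) ∈ Icc (-(Θu φ : ℝ)) (-(Θl φ : ℝ)) → ψ θ = φ θ) →
    η ψ = η φ

/-- The set `Z = {φ ∈ C : Θˡ(φ) = 0}`. -/
def zeroSet (Θl : PhaseSpace r H → Icc (0 : ℝ) r) : Set (PhaseSpace r H) :=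
  {φ | (Θl φ : ℝ) = 0}

/-- The `ω`-neighbourhood `{χ ∈ C : ∃ ν ∈ Z, ‖χ - ν‖ ≤ ω}` of `Z`. -/
def nbhd (ω : ℝ) (Z : Set (PhaseSpace r H)) : Set (PhaseSpace r H) :=
  {χ | ∃ ν ∈ Z, ‖χ - ν‖ ≤ ω}

/-- `S_t`, `t ≥ 0`, is a dynamical system on `C([-r, 0]; H)`. -/
structure IsDynamicalSystem (S : ℝ≥0 → PhaseSpace r H → PhaseSpace r H) : Prop where
  zero : S 0 = id
  add : ∀ t τ : ℝ≥0, S t ∘ S τ = S (t + τ)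
  strongly_continuous : ∀ φ, Continuous fun t => S t φ
  continuous : ∀ t, Continuous (S t)

end Delay

section Mild

variable {H : Type*} [NormedAddCommGroup H] [InnerProductSpace ℝ H] [CompleteSpace H] {r : ℝ≥0}

/-- On `[-r, T]`, the function `w` satisfies the initial condition `w|_{[-r, 0]} = φ` and
`w(t) = e^{-tA} φ(0) + ∫₀ᵗ e^{-(t-s)A} (F(w_s) - d w(s)) ds` for `t ∈ [0, T]`. -/
def SatisfiesIVP (A : H →ₗ.[ℝ] H) (d : ℝ) (B : H → H) (η : PhaseSpace r H → Icc (0 : ℝ) r)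
    (φ : PhaseSpace r H) (T : ℝ≥0) (w : C(ℝ, H)) : Prop :=
  (∀ θ : Icc (-(r : ℝ)) 0, w θ = φ θ) ∧
  ∀ t ∈ Icc (0 : ℝ) T,
    w t = expNeg A t (φ (zeroPt r)) +
      ∫ s in (0 : ℝ)..t, expNeg A (t - s) (delayTerm B η (history r w s) - d • w s)

/-- `u ∈ C([-r, T]; H)` is a mild solution on `[-r, T]` with initial function `φ`. -/
def IsMildSolutionOn (A : H →ₗ.[ℝ] H) (d : ℝ) (B : H → H)
    (η : PhaseSpace r H → Icc (0 : ℝ) r) (φ : PhaseSpace r H) (T : ℝ≥0)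
    (u : C(Icc (-(r : ℝ)) T, H)) : Prop :=
  SatisfiesIVP A d B η φ T (extendIcc u)

/-- `u ∈ C([-r, ∞); H)` is a global mild solution with initial function `φ`: it is a mild solution
on every `[-r, T]`. -/
def IsGlobalMildSolution (A : H →ₗ.[ℝ] H) (d : ℝ) (B : H → H)
    (η : PhaseSpace r H → Icc (0 : ℝ) r) (φ : PhaseSpace r H)
    (u : C(Ici (-(r : ℝ)), H)) : Prop :=
  ∀ T : ℝ≥0, SatisfiesIVP A d B η φ T (extendIci u)

end Mild

end DelayParabolic

end

open DelayParabolic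

open Filter Topology

namespace DelayParabolic


/-! ### The semigroup of `-A` from the spectral theorem -/

section Spectral

variable {H : Type*} [NormedAddCommGroup H] [InnerProductSpace ℝ H]

section Diagonal

/-! Even for Lipschitz `B` and `η` the map φ ↦ B(φ(-η(φ))) need not be locally Lipschitz on C, since
φ is evaluated at a point that moves with φ. What survives is a Lipschitz estimate along curves that
issue from one state φ, for a short time depending on φ (`isLocallyControlled_delayTerm`). Let w_s
stay near φ. If Θˡ(φ) > 0, then for s ≤ Θˡ(φ)/2 the delay η(w_s) depends on w only at times ≤ 0, so
curves with the same past have the same delay and the Lipschitz bound of `B` suffices. If Θˡ(φ) = 0,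
then η(φ) > 0 forces s - η(w_s) ≤ 0 for small s: the value is read off the Lipschitz function φ, at
a point that is Lipschitz in w_s because η is Lipschitz near Z. For pasts that are merely close,
both arguments leave an error that vanishes with their distance.

The rest works for any contraction semigroup and any continuous nonlinearity of linear growth with
this property (`IsAdmissible`). Banach's theorem gives local solutions; absorbing the Lipschitz term
over a short time gives local stability, hence uniqueness. The time step has no uniform lower bound,
so all times are reached by `real_induction`. Its limits from the left rest on the a priori bound
`exists_norm_le_of_isMild` and on the closeness of a solution to the free evolution over short times
(`IsMild.norm_sub_apply_le`).

The semigroup itself is diagonal: the eigenspaces of `A` are those of its compact symmetric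
resolvent, so they decompose H, and nonnegativity of `A` bounds the multipliers by 1. -/

theorem starProjection_eq_zero_of_eq_bot {K : Submodule ℝ H} [K.HasOrthogonalProjection]
    (h : K = ⊥) (v : H) : K.starProjection v = 0 :=
  (Submodule.eq_bot_iff K).1 h _ (K.starProjection_apply_mem v)

variable [CompleteSpace H] {ι : Type*} {V : ι → Submodule ℝ H} [∀ i, (V i).HasOrthogonalProjection]

/-- Parseval's identity and the expansion of a vector along an internal Hilbert sum. -/
theorem hasSum_starProjection
    (hV : IsHilbertSum ℝ (fun i => V i) fun i => (V i).subtypeₗᵢ) (v : H) :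
    HasSum (fun i => (V i).starProjection v) v ∧
      HasSum (fun i => ‖(V i).starProjection v‖ ^ 2) (‖v‖ ^ 2) := by
  obtain ⟨w, hw⟩ := hV.surjective_isometry v
  have hs : HasSum (fun i => ((w i : V i) : H)) v := by
    rw [← hw]; exact hV.OrthogonalFamily.hasSum_linearIsometry w
  have key : ∀ j, (V j).starProjection v = w j := by
    intro j
    have h1 := hs.mapL (V j).starProjection
    have h2 : HasSum (fun i => (V j).starProjection ((w i : V i) : H)) (w j : H) := by
      convert hasSum_single j ?_ using 1
      · exact (Submodule.starProjection_eq_self_iff.2 (w j).2).symm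
      · intro i hij
        rw [Submodule.starProjection_apply_eq_zero_iff, Submodule.mem_orthogonal]
        intro u hu
        exact hV.OrthogonalFamily hij.symm ⟨u, hu⟩ (w i)
    exact h1.unique h2
  refine ⟨by simpa only [key] using hs, ?_⟩
  have h0 : (0 : ℝ) < (2 : ENNReal).toReal := by simp
  have := lp.hasSum_norm h0 w
  rw [← hV.OrthogonalFamily.linearIsometry.norm_map, hw] at this
  simpa [key] using this

/-- The diagonal operator with multipliers `c i` that are bounded on the nonzero summands. -/
theorem hasSum_diagonal
    (hV : IsHilbertSum ℝ (fun i => V i) fun i => (V i).subtypeₗᵢ) {c : ι → ℝ}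
    {M : ℝ} (hc : ∀ i, V i ≠ ⊥ → |c i| ≤ M) (v : H) :
    ∃ y : H, HasSum (fun i => c i • (V i).starProjection v) y ∧
      (∀ i, (V i).starProjection y = c i • (V i).starProjection v) := by
  have hle : ∀ i, ‖c i • (V i).starProjection v‖ ≤ M * ‖(V i).starProjection v‖ := by
    intro i
    rw [norm_smul, Real.norm_eq_abs]
    by_cases hi : V i = ⊥
    · simp [starProjection_eq_zero_of_eq_bot hi]
    · exact mul_le_mul_of_nonneg_right (hc i hi) (norm_nonneg _)
  have hsum := (hasSum_starProjection hV v).2.summable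
  have hsq : Summable fun i => ‖c i • (V i).starProjection v‖ ^ 2 := by
    refine Summable.of_nonneg_of_le (fun i => by positivity) (fun i => ?_) (hsum.mul_left (M ^ 2))
    rw [← mul_pow]
    exact pow_le_pow_left₀ (norm_nonneg _) (hle i) 2
  have hs : Summable fun i => c i • (V i).starProjection v :=
    (hV.OrthogonalFamily.summable_iff_norm_sq_summable
      (fun i => c i • (V i).orthogonalProjectionOnto v)).2 hsq
  refine ⟨_, hs.hasSum, fun j => ?_⟩
  have h1 := hs.hasSum.mapL (V j).starProjection
  have h2 : HasSum (fun i => (V j).starProjection (c i • (V i).starProjection v))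
      (c j • (V j).starProjection v) := by
    convert hasSum_single j ?_ using 1
    · rw [map_smul, Submodule.starProjection_eq_self_iff.2 ((V j).starProjection_apply_mem v)]
    · intro i hij
      rw [map_smul, (Submodule.starProjection_apply_eq_zero_iff _).2, smul_zero]
      rw [Submodule.mem_orthogonal]
      intro u hu
      exact hV.OrthogonalFamily hij.symm ⟨u, hu⟩ ⟨_, (V i).starProjection_apply_mem v⟩
  exact h1.unique h2

end Diagonal

variable {A : H →ₗ.[ℝ] H}

theorem mem_eigenspace_iff {μ : ℝ} {x : H} :
    x ∈ eigenspace A μ ↔ ∃ y : A.domain, A y = μ • (y : H) ∧ (y : H) = x := by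
  simp only [eigenspace, Submodule.mem_map, LinearMap.mem_ker, LinearMap.sub_apply,
    LinearMap.smul_apply, Submodule.subtype_apply, sub_eq_zero]
  rfl

theorem inner_apply_eq [CompleteSpace H] (hA : Dense (A.domain : Set H)) (hs : IsSelfAdjoint A)
    (x y : A.domain) : inner ℝ (A x) (y : H) = inner ℝ (x : H) (A y) := by
  have h := LinearPMap.adjoint_isFormalAdjoint hA
  rw [LinearPMap.isSelfAdjoint_def.1 hs] at h
  exact h x y

/-- Apply `R` to (A + κ)x = (μ + κ)x. No case μ = -κ has to be excluded: both sides are then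
trivial. -/
theorem eigenspace_eq_ker {κ : ℝ} {R : H →L[ℝ] H}
    (hl : ∀ x : A.domain, R (A x + κ • (x : H)) = x)
    (hr : ∀ y : H, ∃ x : A.domain, (x : H) = R y ∧ A x + κ • (x : H) = y) (μ : ℝ) :
    eigenspace A μ = ((μ + κ) • R - ContinuousLinearMap.id ℝ H).ker := by
  ext x
  simp only [mem_eigenspace_iff, LinearMap.mem_ker]
  change _ ↔ (μ + κ) • R x - x = 0
  rw [sub_eq_zero]
  constructor
  · rintro ⟨y, hy, rfl⟩
    have := hl y
    rwa [hy, ← add_smul, map_smul] at this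
  · intro h
    obtain ⟨z, hz, hz'⟩ := hr ((μ + κ) • x)
    rw [map_smul, h] at hz
    refine ⟨z, ?_, hz⟩
    rw [hz, add_smul] at hz'
    rw [hz]
    exact add_right_cancel hz'

theorem nonneg_of_eigenspace_ne_bot
    (hA_nonneg : ∀ x : A.domain, 0 ≤ inner ℝ (A x) (x : H)) {μ : ℝ}
    (h : eigenspace A μ ≠ ⊥) : 0 ≤ μ := by
  obtain ⟨x, hx, hx0⟩ := Submodule.exists_mem_ne_zero_of_ne_bot h
  obtain ⟨y, hy, rfl⟩ := mem_eigenspace_iff.1 hx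
  have := hA_nonneg y
  rw [hy, real_inner_smul_left, real_inner_self_eq_norm_sq] at this
  exact nonneg_of_mul_nonneg_left this (by positivity)

theorem isClosed_eigenspace (hA_res : HasCompactResolvent A) (μ : ℝ) :
    IsClosed (eigenspace A μ : Set H) := by
  obtain ⟨κ, R, -, hl, hr⟩ := hA_res
  rw [eigenspace_eq_ker hl hr]
  exact ContinuousLinearMap.isClosed_ker _

variable [CompleteSpace H]

/-- Orthogonality is the symmetry of `A`. Totality comes from the compact symmetric operator `R`,
whose eigenvectors for l ≠ 0 are eigenvectors of `A` for l⁻¹ - κ. -/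
theorem isHilbertSum_eigenspace (hA : Dense (A.domain : Set H)) (hs : IsSelfAdjoint A)
    (hA_res : HasCompactResolvent A) :
    IsHilbertSum ℝ (fun μ => (eigenspace A μ).topologicalClosure)
      fun μ => ((eigenspace A μ).topologicalClosure).subtypeₗᵢ := by
  have hcl : ∀ μ, (eigenspace A μ).topologicalClosure = eigenspace A μ := fun μ =>
    (isClosed_eigenspace hA_res μ).submodule_topologicalClosure_eq
  refine IsHilbertSum.mkInternal
    (F := fun μ => (eigenspace A μ).topologicalClosure) ?_ ?_
  · rintro μ ν hμν ⟨_, hx'⟩ ⟨_, hy'⟩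
    obtain ⟨x, hx, rfl⟩ := mem_eigenspace_iff.1 ((hcl μ).le hx')
    obtain ⟨y, hy, rfl⟩ := mem_eigenspace_iff.1 ((hcl ν).le hy')
    have h := inner_apply_eq hA hs x y
    rw [hx, hy, real_inner_smul_left, real_inner_smul_right] at h
    have : (μ - ν) * inner ℝ (x : H) (y : H) = 0 := by linarith
    exact (mul_eq_zero.1 this).resolve_left (sub_ne_zero.2 hμν)
  · simp only [hcl]
    obtain ⟨κ, R, hc, hl, hr⟩ := hA_res
    have hsym : (R : H →ₗ[ℝ] H).IsSymmetric := by
      intro x y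
      obtain ⟨u, hu, hu'⟩ := hr x
      obtain ⟨v, hv, hv'⟩ := hr y
      change inner ℝ (R x) y = inner ℝ x (R y)
      rw [← hu, ← hv, ← hu', ← hv', inner_add_left, inner_add_right, real_inner_smul_left,
        real_inner_smul_right, inner_apply_eq hA hs]
    have hbot := ContinuousLinearMap.orthogonalComplement_iSup_eigenspaces_eq_bot hc hsym
    have hle : (⨆ μ, Module.End.eigenspace (R : H →ₗ[ℝ] H) μ) ≤ ⨆ μ, eigenspace A μ := by
      refine iSup_le fun l => ?_
      refine le_trans ?_ (le_iSup _ (l⁻¹ - κ))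
      intro x hx
      rw [Module.End.mem_eigenspace_iff] at hx
      change R x = l • x at hx
      rw [eigenspace_eq_ker hl hr, LinearMap.mem_ker]
      change (l⁻¹ - κ + κ) • R x - x = 0
      rw [sub_add_cancel, hx]
      -- The eigenvalue 0 contributes nothing, because `R` is injective.
      by_cases h0 : l = 0
      · obtain ⟨z, hz, hz'⟩ := hr x
        rw [hx, h0, zero_smul] at hz
        have : z = 0 := Subtype.ext hz
        subst this
        simp at hz'
        simp [← hz']
      · rw [inv_smul_smul₀ h0, sub_self]
    rw [top_le_iff, Submodule.topologicalClosure_eq_top_iff, ← le_bot_iff]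
    exact (Submodule.orthogonal_le hle).trans hbot.le

/-- A strongly continuous contraction semigroup on `[0, ∞)`, extended to a strongly continuous family
of contractions on `ℝ`. -/
structure IsContractionSemigroup {H : Type*} [NormedAddCommGroup H] [NormedSpace ℝ H]
    (E : ℝ → H →L[ℝ] H) : Prop where
  apply_zero : ∀ x, E 0 x = x
  apply_add : ∀ s t : ℝ, 0 ≤ s → 0 ≤ t → ∀ x, E (s + t) x = E s (E t x)
  norm_apply_le : ∀ t x, ‖E t x‖ ≤ ‖x‖
  continuous_apply : ∀ x, Continuous fun t => E t x

/-- Each property is checked on the spectral coefficients: a vector is determined by its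
projections, and norms are computed by Parseval. -/
theorem exists_isContractionSemigroup_expNeg (hA : Dense (A.domain : Set H))
    (hs : IsSelfAdjoint A) (hA_nonneg : ∀ x : A.domain, 0 ≤ inner ℝ (A x) (x : H))
    (hA_res : HasCompactResolvent A) :
    ∃ E : ℝ → H →L[ℝ] H, IsContractionSemigroup E ∧
      ∀ t, 0 ≤ t → ∀ x, E t x = expNeg A t x := by
  have hV := isHilbertSum_eigenspace hA hs hA_res
  set V : ℝ → Submodule ℝ H := fun μ => (eigenspace A μ).topologicalClosure with hVdef
  have hpos : ∀ μ, V μ ≠ ⊥ → 0 ≤ μ := fun μ h =>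
    nonneg_of_eigenspace_ne_bot hA_nonneg (by
      rwa [← (isClosed_eigenspace hA_res μ).submodule_topologicalClosure_eq])
  -- The multipliers are unbounded over negative μ, but there the eigenspaces are trivial.
  have habs : ∀ t : ℝ, 0 ≤ t → ∀ μ, V μ ≠ ⊥ → |Real.exp (-(t * μ))| ≤ 1 := fun t ht μ h => by
    rw [Real.abs_exp, Real.exp_le_one_iff]
    linarith [mul_nonneg ht (hpos μ h)]
  have hsum : ∀ t : ℝ, 0 ≤ t → ∀ v, HasSum
      (fun μ => Real.exp (-(t * μ)) • (V μ).starProjection v) (expNeg A t v) := fun t ht v => by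
    obtain ⟨y, hy, -⟩ := hasSum_diagonal hV (habs t ht) v
    exact hy.summable.hasSum
  have hproj : ∀ t : ℝ, 0 ≤ t → ∀ v μ, (V μ).starProjection (expNeg A t v) =
      Real.exp (-(t * μ)) • (V μ).starProjection v := fun t ht v μ => by
    obtain ⟨y, hy, hy'⟩ := hasSum_diagonal hV (habs t ht) v
    rw [(hsum t ht v).unique hy, hy']
  have hext : ∀ x y : H, (∀ μ, (V μ).starProjection x = (V μ).starProjection y) → x = y :=
    fun x y h => (hasSum_starProjection hV x).1.unique (by
      have hy := (hasSum_starProjection hV y).1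
      rwa [funext fun μ => (h μ).symm] at hy)
  have hnorm : ∀ t : ℝ, 0 ≤ t → ∀ v, ‖expNeg A t v‖ ≤ ‖v‖ := fun t ht v => by
    refine (sq_le_sq₀ (norm_nonneg _) (norm_nonneg v)).1 ?_
    refine hasSum_le (fun μ => ?_) (hasSum_starProjection hV _).2 (hasSum_starProjection hV v).2
    rw [hproj t ht]
    by_cases h : V μ = ⊥
    · simp [starProjection_eq_zero_of_eq_bot h]
    · rw [norm_smul, Real.norm_eq_abs]
      exact pow_le_pow_left₀ (by positivity)
        (mul_le_of_le_one_left (norm_nonneg _) (habs t ht μ h)) 2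
  have hadd : ∀ t : ℝ, 0 ≤ t → ∀ v w, expNeg A t (v + w) = expNeg A t v + expNeg A t w :=
    fun t ht v w => hext _ _ fun μ => by
      rw [map_add, hproj t ht, hproj t ht, hproj t ht, map_add, smul_add]
  have hsmul : ∀ t : ℝ, 0 ≤ t → ∀ (a : ℝ) v, expNeg A t (a • v) = a • expNeg A t v :=
    fun t ht a v => hext _ _ fun μ => by
      rw [map_smul, hproj t ht, hproj t ht, map_smul, smul_comm]
  have hcont : ∀ v, Continuous fun t : ℝ => expNeg A (max t 0) v := by
    intro v
    rw [continuous_iff_continuousAt]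
    intro t₀
    rw [ContinuousAt, tendsto_iff_norm_sub_tendsto_zero]
    -- Strong continuity is dominated convergence in Parseval's sum, with the coefficients of v as
    -- majorant.
    have hsq : Tendsto (fun t : ℝ => ∑' μ, ‖(V μ).starProjection
        (expNeg A (max t 0) v - expNeg A (max t₀ 0) v)‖ ^ 2) (𝓝 t₀) (𝓝 (∑' _ : ℝ, (0 : ℝ))) := by
      refine tendsto_tsum_of_dominated_convergence
        (bound := fun μ => (2 * ‖(V μ).starProjection v‖) ^ 2) ?_ ?_ ?_
      · simpa only [mul_pow] using (hasSum_starProjection hV v).2.summable.mul_left (2 ^ 2)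
      · intro μ
        have : Continuous fun t : ℝ => ‖Real.exp (-(max t 0 * μ)) • (V μ).starProjection v -
            Real.exp (-(max t₀ 0 * μ)) • (V μ).starProjection v‖ ^ 2 := by fun_prop
        have h := this.tendsto t₀
        simp only [sub_self, norm_zero] at h
        simpa [map_sub, hproj _ (le_max_right _ _)] using h
      · refine Eventually.of_forall fun t μ => ?_
        rw [Real.norm_eq_abs, abs_of_nonneg (by positivity), map_sub,
          hproj _ (le_max_right _ _), hproj _ (le_max_right _ _)]
        refine pow_le_pow_left₀ (norm_nonneg _) ?_ 2
        by_cases h : V μ = ⊥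
        · simp [starProjection_eq_zero_of_eq_bot h]
        · refine (norm_sub_le _ _).trans ?_
          rw [norm_smul, norm_smul, Real.norm_eq_abs, Real.norm_eq_abs, two_mul]
          exact add_le_add
            (mul_le_of_le_one_left (norm_nonneg _) (habs _ (le_max_right _ _) μ h))
            (mul_le_of_le_one_left (norm_nonneg _) (habs _ (le_max_right _ _) μ h))
    have h2 := hsq.sqrt
    simp only [tsum_zero, Real.sqrt_zero] at h2
    refine h2.congr fun t => ?_
    rw [(hasSum_starProjection hV _).2.tsum_eq, Real.sqrt_sq (norm_nonneg _)]
  refine ⟨fun t => LinearMap.mkContinuous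
    { toFun := expNeg A (max t 0)
      map_add' := hadd _ (le_max_right _ _)
      map_smul' := hsmul _ (le_max_right _ _) } 1
      (fun x => by simpa using hnorm _ (le_max_right _ _) x), ⟨?_, ?_, ?_, ?_⟩, ?_⟩
  · intro x
    refine hext _ _ fun μ => ?_
    change (V μ).starProjection (expNeg A (max 0 0) x) = _
    rw [hproj _ (le_max_right _ _)]
    simp
  · intro s t h0s h0t x
    change expNeg A (max (s + t) 0) x = expNeg A (max s 0) (expNeg A (max t 0) x)
    rw [max_eq_left h0s, max_eq_left h0t, max_eq_left (add_nonneg h0s h0t)]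
    refine hext _ _ fun μ => ?_
    rw [hproj _ h0s, hproj _ h0t, hproj _ (add_nonneg h0s h0t), smul_smul, ← Real.exp_add]
    congr 2
    ring
  · exact fun t x => hnorm _ (le_max_right _ _) x
  · exact hcont
  · intro t ht x
    change expNeg A (max t 0) x = _
    rw [max_eq_left ht]

end Spectral


/-! ### Mild solutions for a contraction semigroup: restarting, gluing, a priori bounds -/

section MildTheory

/-- The infimum of the times where `P` fails satisfies `P` by `zero` or `left`, and `right` leads
beyond it. The gain `δ` may depend on `t`, as local existence and stability times do. -/
theorem real_induction {P : ℝ → Prop} (zero : P 0)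
    (right : ∀ t, 0 ≤ t → P t → ∃ δ > 0, ∀ s ∈ Icc t (t + δ), P s)
    (left : ∀ t, 0 < t → (∀ s ∈ Ico 0 t, P s) → P t) : ∀ t, 0 ≤ t → P t := by
  by_contra! hneg
  set N : Set ℝ := {t | 0 ≤ t ∧ ¬ P t} with hN
  have hne : N.Nonempty := hneg
  have hbdd : BddBelow N := ⟨0, fun t ht => ht.1⟩
  have h0 : 0 ≤ sInf N := le_csInf hne fun t ht => ht.1
  have hlt : ∀ s ∈ Ico 0 (sInf N), P s := fun s hs => by
    by_contra h
    exact absurd (csInf_le hbdd ⟨hs.1, h⟩) (not_le.2 hs.2)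
  have hP : P (sInf N) := by
    rcases h0.eq_or_lt with h | h
    · rwa [← h]
    · exact left _ h hlt
  obtain ⟨δ, hδ, h⟩ := right _ h0 hP
  obtain ⟨t, ht, htlt⟩ := exists_lt_of_csInf_lt hne (lt_add_of_pos_right _ hδ)
  exact ht.2 (h t ⟨csInf_le hbdd ht, htlt.le⟩)

variable {H : Type*} [NormedAddCommGroup H] {r : ℝ≥0}

theorem history_apply (w : C(ℝ, H)) (t : ℝ) (θ : Icc (-(r : ℝ)) 0) :
    history r w t θ = w (t + θ) := rfl

theorem continuous_history (w : C(ℝ, H)) : Continuous fun t => history r w t := by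
  refine ContinuousMap.continuous_of_continuous_uncurry _ ?_
  change Continuous fun p : ℝ × Icc (-(r : ℝ)) 0 => w (p.1 + p.2)
  fun_prop

theorem continuous_comp_history {X : Type*} [TopologicalSpace X] {G : PhaseSpace r H → X}
    (hG : Continuous G) (w : C(ℝ, H)) : Continuous fun t => G (history r w t) :=
  hG.comp (continuous_history w)

/-- The translate `s ↦ w (a + s)`. -/
def translate (a : ℝ) (w : C(ℝ, H)) : C(ℝ, H) where
  toFun s := w (a + s)
  continuous_toFun := by fun_prop

theorem translate_apply (a : ℝ) (w : C(ℝ, H)) (s : ℝ) : translate a w s = w (a + s) := rfl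

theorem history_translate (a : ℝ) (w : C(ℝ, H)) (s : ℝ) :
    history r (translate a w) s = history r w (a + s) := by
  ext θ
  simp [history_apply, translate_apply, add_assoc]

theorem history_congr {w v : C(ℝ, H)} {t T : ℝ} (h : ∀ x ∈ Icc (-(r : ℝ)) T, w x = v x)
    (ht : t ∈ Icc 0 T) : history r w t = history r v t := by
  ext θ
  exact h _ ⟨by linarith [θ.2.1, ht.1], by linarith [θ.2.2, ht.2]⟩

theorem history_zero_eq {w : C(ℝ, H)} {φ : PhaseSpace r H}
    (h : ∀ θ : Icc (-(r : ℝ)) 0, w θ = φ θ) : history r w 0 = φ := by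
  ext θ
  rw [history_apply, zero_add, h]

theorem zeroPt_coe : ((zeroPt r : Icc (-(r : ℝ)) 0) : ℝ) = 0 := rfl

theorem history_zeroPt (w : C(ℝ, H)) (t : ℝ) : history r w t (zeroPt r) = w t := by
  rw [history_apply, zeroPt_coe, add_zero]

variable [NormedSpace ℝ H]

variable {E : ℝ → H →L[ℝ] H} {G : PhaseSpace r H → H} {φ ψ : PhaseSpace r H} {T : ℝ}
  {w v : C(ℝ, H)}

theorem IsContractionSemigroup.continuous_uncurry (hE : IsContractionSemigroup E) :
    Continuous fun p : ℝ × H => E p.1 p.2 := by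
  refine continuous_prod_of_continuous_lipschitzWith' _ 1 (fun t => ?_) hE.continuous_apply
  refine LipschitzWith.of_dist_le_mul fun x y => ?_
  rw [dist_eq_norm, dist_eq_norm, ← map_sub, NNReal.coe_one, one_mul]
  exact hE.norm_apply_le _ _

theorem IsContractionSemigroup.continuous_convolution_integrand (hE : IsContractionSemigroup E)
    {g : ℝ → H} (hg : Continuous g) (t : ℝ) : Continuous fun s => E (t - s) (g s) :=
  hE.continuous_uncurry.comp ((continuous_const.sub continuous_id).prodMk hg)

theorem IsContractionSemigroup.continuous_convolution (hE : IsContractionSemigroup E)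
    {g : ℝ → H} (hg : Continuous g) : Continuous fun t => ∫ s in (0 : ℝ)..t, E (t - s) (g s) := by
  refine intervalIntegral.continuous_parametric_intervalIntegral_of_continuous ?_ continuous_id
  exact hE.continuous_uncurry.comp
    ((continuous_fst.sub continuous_snd).prodMk (hg.comp continuous_snd))

/-- Split the integral at `a` and pull `E t` out of the first part. This identity allows a mild
solution to be restarted at `a`. -/
theorem IsContractionSemigroup.duhamel_add [CompleteSpace H] (hE : IsContractionSemigroup E)
    {g : ℝ → H}
    (hg : Continuous g) {a t : ℝ} (ha : 0 ≤ a) (ht : 0 ≤ t) (x : H) :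
    E (a + t) x + ∫ s in (0 : ℝ)..(a + t), E (a + t - s) (g s) =
      E t (E a x + ∫ s in (0 : ℝ)..a, E (a - s) (g s)) +
        ∫ s in (0 : ℝ)..t, E (t - s) (g (a + s)) := by
  have hi : ∀ b c e : ℝ, IntervalIntegrable (fun s => E (e - s) (g s)) volume b c :=
    fun b c e => (hE.continuous_convolution_integrand hg e).intervalIntegrable b c
  rw [← intervalIntegral.integral_add_adjacent_intervals (hi 0 a (a + t)) (hi a (a + t) (a + t)),
    map_add, ← ContinuousLinearMap.intervalIntegral_comp_comm _ (hi 0 a a), add_comm a t,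
    hE.apply_add t a ht ha, add_assoc]
  congr 2
  · refine intervalIntegral.integral_congr fun s hs => ?_
    rw [uIcc_of_le ha] at hs
    change _ = E t (E (a - s) (g s))
    rw [← hE.apply_add t (a - s) ht (by linarith [hs.2]), add_sub_assoc]
  · have := intervalIntegral.integral_comp_add_left (a := 0) (b := t)
      (fun s => E (t + a - s) (g s)) a
    rw [add_zero, add_comm a t] at this
    rw [← this]
    refine intervalIntegral.integral_congr fun s _ => ?_
    congr 2
    ring

/-- On `[-r, T]`, the function `w` is the mild solution of `u' = -A u + G(u_t)`, `u_0 = φ`, where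
`-A` generates `E`. -/
def IsMild (E : ℝ → H →L[ℝ] H) (G : PhaseSpace r H → H) (φ : PhaseSpace r H) (T : ℝ)
    (w : C(ℝ, H)) : Prop :=
  (∀ θ : Icc (-(r : ℝ)) 0, w θ = φ θ) ∧
  ∀ t ∈ Icc (0 : ℝ) T,
    w t = E t (φ (zeroPt r)) + ∫ s in (0 : ℝ)..t, E (t - s) (G (history r w s))

theorem IsMild.mono {T' : ℝ} (h : IsMild E G φ T w) (hT : T' ≤ T) : IsMild E G φ T' w :=
  ⟨h.1, fun t ht => h.2 t ⟨ht.1, ht.2.trans hT⟩⟩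

theorem IsMild.congr (h : IsMild E G φ T w) (hT : 0 ≤ T)
    (hwv : ∀ x ∈ Icc (-(r : ℝ)) T, w x = v x) : IsMild E G φ T v := by
  refine ⟨fun θ => ?_, fun t ht => ?_⟩
  · rw [← h.1, hwv _ ⟨θ.2.1, θ.2.2.trans hT⟩]
  · rw [← hwv t ⟨(neg_nonpos.2 r.2).trans ht.1, ht.2⟩, h.2 t ht]
    congr 1
    refine intervalIntegral.integral_congr fun s hs => ?_
    rw [uIcc_of_le ht.1] at hs
    rw [history_congr hwv ⟨hs.1, hs.2.trans ht.2⟩]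

theorem IsMild.eq_of_nonpos (hw : IsMild E G φ T w) (hv : IsMild E G φ T v) {x : ℝ}
    (hx : x ∈ Icc (-(r : ℝ)) 0) : w x = v x := by
  rw [hw.1 ⟨x, hx⟩, hv.1 ⟨x, hx⟩]

theorem isMild_zero (hE : IsContractionSemigroup E) (h : ∀ θ : Icc (-(r : ℝ)) 0, w θ = φ θ) :
    IsMild E G φ 0 w := by
  refine ⟨h, fun t ht => ?_⟩
  obtain rfl : t = 0 := le_antisymm ht.2 ht.1
  have := h (zeroPt r)
  rw [zeroPt_coe] at this
  rw [hE.apply_zero, intervalIntegral.integral_same, add_zero, this]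

variable [CompleteSpace H]

theorem IsMild.translate_of_add (hE : IsContractionSemigroup E) (hG : Continuous G) {a b : ℝ}
    (ha : 0 ≤ a) (hb : 0 ≤ b) (h : IsMild E G φ (a + b) w) :
    IsMild E G (history r w a) b (translate a w) := by
  refine ⟨fun θ => rfl, fun t ht => ?_⟩
  rw [translate_apply, h.2 (a + t) ⟨add_nonneg ha ht.1, by linarith [ht.2]⟩,
    hE.duhamel_add (continuous_comp_history hG w) ha ht.1, history_zeroPt,
    h.2 a ⟨ha, by linarith⟩]
  simp only [history_translate]

theorem isMild_add (hE : IsContractionSemigroup E) (hG : Continuous G) {a b : ℝ}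
    (ha : 0 ≤ a) (h : IsMild E G φ a w)
    (h' : IsMild E G (history r w a) b (translate a w)) : IsMild E G φ (a + b) w := by
  refine ⟨h.1, fun t ht => ?_⟩
  rcases le_total t a with hta | hta
  · exact h.2 t ⟨ht.1, hta⟩
  · obtain ⟨s, rfl⟩ : ∃ s, t = a + s := ⟨t - a, by ring⟩
    have hs : 0 ≤ s := by linarith
    rw [← translate_apply, h'.2 s ⟨hs, by linarith [ht.2]⟩,
      hE.duhamel_add (continuous_comp_history hG w) ha hs, history_zeroPt,
      h.2 a ⟨ha, le_rfl⟩]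
    simp only [history_translate]

theorem IsMild.glue (hE : IsContractionSemigroup E) (hG : Continuous G) {a b : ℝ}
    (ha : 0 ≤ a) (hb : 0 ≤ b) (hw : IsMild E G φ a w) (hv : IsMild E G (history r w a) b v) :
    ∃ u, IsMild E G φ (a + b) u := by
  have hv0 : v 0 = w a := by
    have := hv.1 (zeroPt r)
    rwa [history_zeroPt, zeroPt_coe] at this
  have hcont : Continuous fun t : ℝ => if t ≤ a then w t else v (t - a) := by
    refine Continuous.if_le w.continuous (by fun_prop) continuous_id continuous_const ?_
    rintro t rfl
    rw [sub_self, hv0]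
  let u : C(ℝ, H) := ⟨_, hcont⟩
  have hu1 : ∀ t ≤ a, u t = w t := fun t ht => if_pos ht
  have hu2 : ∀ x ∈ Icc (-(r : ℝ)) b, v x = translate a u x := by
    intro x hx
    rw [translate_apply]
    rcases le_or_gt x 0 with h | h
    · rw [hu1 _ (by linarith)]
      exact hv.1 ⟨x, hx.1, h⟩
    · have : ¬ a + x ≤ a := by linarith
      change _ = if a + x ≤ a then _ else _
      rw [if_neg this, add_sub_cancel_left]
  refine ⟨u, isMild_add hE hG ha (hw.congr ha fun x hx => (hu1 x hx.2).symm) ?_⟩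
  have : history r u a = history r w a :=
    history_congr (T := a) (fun x hx => hu1 x hx.2) ⟨ha, le_rfl⟩
  rw [this]
  exact hv.congr hb hu2

omit [CompleteSpace H] in
theorem IsContractionSemigroup.norm_convolution_le (hE : IsContractionSemigroup E) {g : ℝ → H}
    {t M : ℝ} (ht : 0 ≤ t) (hg : ∀ s ∈ Icc 0 t, ‖g s‖ ≤ M) :
    ‖∫ s in (0 : ℝ)..t, E (t - s) (g s)‖ ≤ M * t := by
  have := intervalIntegral.norm_integral_le_of_norm_le_const (a := 0) (b := t)
    (f := fun s => E (t - s) (g s)) (C := M) (fun s hs => by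
      rw [uIoc_of_le ht] at hs
      exact (hE.norm_apply_le _ _).trans (hg s ⟨hs.1.le, hs.2⟩))
  rwa [sub_zero, abs_of_nonneg ht] at this

omit [CompleteSpace H] in
theorem IsMild.norm_sub_le (hE : IsContractionSemigroup E) (hG : Continuous G) {M t : ℝ}
    (hw : IsMild E G ψ T w) (hv : IsMild E G φ T v) (ht : t ∈ Icc 0 T)
    (hM : ∀ s ∈ Icc 0 t, ‖G (history r w s) - G (history r v s)‖ ≤ M) :
    ‖w t - v t‖ ≤ ‖ψ - φ‖ + M * t := by
  have hi : ∀ w : C(ℝ, H), IntervalIntegrable (fun s => E (t - s) (G (history r w s)))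
      volume 0 t := fun w =>
    (hE.continuous_convolution_integrand (continuous_comp_history hG w) t).intervalIntegrable _ _
  have key : w t - v t = E t ((ψ - φ) (zeroPt r)) +
      ∫ s in (0 : ℝ)..t, E (t - s) (G (history r w s) - G (history r v s)) := by
    simp only [map_sub]
    rw [intervalIntegral.integral_sub (hi w) (hi v), hw.2 t ht, hv.2 t ht,
      ContinuousMap.sub_apply, map_sub]
    abel
  rw [key]
  refine (norm_add_le _ _).trans (add_le_add ?_ (hE.norm_convolution_le ht.1 hM))
  exact (hE.norm_apply_le _ _).trans (ContinuousMap.norm_coe_le_norm _ _)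

/-- Restart at `a` and bound the integral. Mild solutions need not be Lipschitz in time; this
comparison with the free evolution is the substitute. -/
theorem IsMild.norm_sub_apply_le (hE : IsContractionSemigroup E) (hG : Continuous G)
    {M a t : ℝ} (hw : IsMild E G φ T w) (ha : 0 ≤ a) (hat : a ≤ t) (ht : t ≤ T)
    (hM : ∀ s ∈ Icc 0 T, ‖G (history r w s)‖ ≤ M) :
    ‖w t - E (t - a) (w a)‖ ≤ M * (t - a) := by
  have h := IsMild.translate_of_add hE hG ha (sub_nonneg.2 hat)
    (hw.mono (by linarith : a + (t - a) ≤ T))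
  have h2 := h.2 (t - a) ⟨sub_nonneg.2 hat, le_rfl⟩
  rw [translate_apply, add_sub_cancel, history_zeroPt] at h2
  rw [h2, add_sub_cancel_left]
  refine hE.norm_convolution_le (sub_nonneg.2 hat) fun s hs => ?_
  rw [history_translate]
  exact hM _ ⟨add_nonneg ha hs.1, by linarith [hs.2]⟩

omit [NormedSpace ℝ H] [CompleteSpace H] in
theorem norm_history_sub_le {C t : ℝ} (ht : 0 ≤ t)
    (h0 : ∀ θ : Icc (-(r : ℝ)) 0, ‖w θ - v θ‖ ≤ C) (h : ∀ s ∈ Icc 0 t, ‖w s - v s‖ ≤ C) :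
    ‖history r w t - history r v t‖ ≤ C := by
  refine (ContinuousMap.norm_le _ ((norm_nonneg _).trans (h0 (zeroPt r)))).2 fun θ => ?_
  rw [ContinuousMap.sub_apply, history_apply, history_apply]
  rcases le_total (t + θ) 0 with hθ | hθ
  · exact h0 ⟨t + θ, by linarith [θ.2.1], hθ⟩
  · exact h _ ⟨hθ, by linarith [θ.2.2]⟩

omit [NormedSpace ℝ H] [CompleteSpace H] in
theorem norm_history_le {C t : ℝ} (ht : 0 ≤ t)
    (h0 : ∀ θ : Icc (-(r : ℝ)) 0, ‖w θ‖ ≤ C) (h : ∀ s ∈ Icc 0 t, ‖w s‖ ≤ C) :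
    ‖history r w t‖ ≤ C := by
  have := norm_history_sub_le (w := w) (v := 0) ht (by simpa using h0) (by simpa using h)
  have h2 : history r (0 : C(ℝ, H)) t = 0 := rfl
  rwa [h2, sub_zero] at this

omit [CompleteSpace H] in
-- Gronwall's estimate, by evaluating the equation at a maximum `p` of the weighted norm e^{-lt}‖w
-- t‖. The bound depends only on `S` and `R`, not on the solution or its horizon.
theorem exists_norm_le_of_isMild (hE : IsContractionSemigroup E) {a b : ℝ}
    (ha : 0 ≤ a) (hb : 0 ≤ b) (hgrowth : ∀ χ, ‖G χ‖ ≤ a + b * ‖χ‖) {S R : ℝ} (hS : 0 ≤ S)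
    (hR : 0 ≤ R) :
    ∃ M, 0 ≤ M ∧ ∀ (φ : PhaseSpace r H) (w : C(ℝ, H)) (T : ℝ), ‖φ‖ ≤ R → T ≤ S →
      IsMild E G φ T w → ∀ t ∈ Icc 0 T, ‖G (history r w t)‖ ≤ M := by
  -- Since b/l ≤ 1/2, the delayed term costs at most half of the weighted maximum `N`, so N ≤ N₀/2 +
  -- N/2.
  set l : ℝ := 2 * b + 1 with hl
  have hl0 : 0 < l := by positivity
  set N₀ : ℝ := 2 * (R + (a + b * R) * S) with hN₀
  have hN₀_nonneg : 0 ≤ N₀ := by positivity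
  refine ⟨a + b * (R + Real.exp (l * S) * N₀), by positivity, ?_⟩
  intro φ w T hφ hTS hw t ht
  have hT : 0 ≤ T := ht.1.trans ht.2
  obtain ⟨p, hp, hmax⟩ := isCompact_Icc.exists_isMaxOn (nonempty_Icc.2 hT)
    (f := fun t => Real.exp (-(l * t)) * ‖w t‖) (by fun_prop)
  set N : ℝ := Real.exp (-(l * p)) * ‖w p‖ with hN
  have hN_nonneg : 0 ≤ N := by positivity
  have hw0 : ∀ θ : Icc (-(r : ℝ)) 0, ‖w θ‖ ≤ R := fun θ => by
    rw [hw.1]; exact (ContinuousMap.norm_coe_le_norm _ _).trans hφ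
  have hwN : ∀ s ∈ Icc 0 T, ‖w s‖ ≤ Real.exp (l * s) * N := fun s hs => by
    have h : Real.exp (-(l * s)) * ‖w s‖ ≤ N := hmax hs
    have h2 := mul_le_mul_of_nonneg_left h (Real.exp_pos (l * s)).le
    rwa [← mul_assoc, ← Real.exp_add, add_neg_cancel, Real.exp_zero, one_mul] at h2
  have hhist : ∀ s ∈ Icc 0 T, ‖history r w s‖ ≤ R + Real.exp (l * s) * N := fun s hs => by
    refine norm_history_le hs.1 (fun θ => (hw0 θ).trans ?_) fun x hx => ?_
    · exact le_add_of_nonneg_right (by positivity)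
    · refine (hwN x ⟨hx.1, hx.2.trans hs.2⟩).trans ?_
      refine le_trans ?_ (le_add_of_nonneg_left hR)
      have : l * x ≤ l * s := mul_le_mul_of_nonneg_left hx.2 hl0.le
      gcongr
  have hint : ‖∫ s in (0 : ℝ)..p, E (p - s) (G (history r w s))‖ ≤
      ∫ s in (0 : ℝ)..p, ((a + b * R) + b * N * Real.exp (l * s)) := by
    refine intervalIntegral.norm_integral_le_of_norm_le hp.1 ?_
      (Continuous.intervalIntegrable (by fun_prop) _ _)
    refine Eventually.of_forall fun s hs => (hE.norm_apply_le _ _).trans ?_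
    refine (hgrowth _).trans ?_
    have := mul_le_mul_of_nonneg_left (hhist s ⟨hs.1.le, hs.2.trans hp.2⟩) hb
    linarith
  have hcalc : ∫ s in (0 : ℝ)..p, ((a + b * R) + b * N * Real.exp (l * s)) =
      (a + b * R) * p + b * N * ((Real.exp (l * p) - 1) / l) := by
    rw [intervalIntegral.integral_add (by simp)
      (Continuous.intervalIntegrable (by fun_prop) _ _), intervalIntegral.integral_const,
      intervalIntegral.integral_const_mul, intervalIntegral.integral_comp_mul_left _ hl0.ne',
      integral_exp]
    simp only [smul_eq_mul, mul_zero, Real.exp_zero, sub_zero]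
    ring
  have hwp : ‖w p‖ ≤ R + ((a + b * R) * p + b * N * ((Real.exp (l * p) - 1) / l)) := by
    rw [hw.2 p hp]
    refine (norm_add_le _ _).trans (add_le_add ?_ (hint.trans hcalc.le))
    exact (hE.norm_apply_le _ _).trans ((ContinuousMap.norm_coe_le_norm _ _).trans hφ)
  have hbl : b * N * ((Real.exp (l * p) - 1) / l) ≤ Real.exp (l * p) * (N / 2) := by
    have h1 : (Real.exp (l * p) - 1) / l * b ≤ Real.exp (l * p) * (1 / 2) := by
      rw [div_mul_eq_mul_div, div_le_iff₀ hl0, hl]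
      nlinarith [Real.exp_pos (l * p)]
    calc _ = ((Real.exp (l * p) - 1) / l * b) * N := by ring
      _ ≤ (Real.exp (l * p) * (1 / 2)) * N := mul_le_mul_of_nonneg_right h1 hN_nonneg
      _ = _ := by ring
  have hN_le : N ≤ R + (a + b * R) * S + N / 2 := by
    have h1 : ‖w p‖ ≤ (R + (a + b * R) * S) + Real.exp (l * p) * (N / 2) := by
      have : (a + b * R) * p ≤ (a + b * R) * S :=
        mul_le_mul_of_nonneg_left (hp.2.trans hTS) (by positivity)
      linarith
    have h2 : Real.exp (-(l * p)) ≤ 1 := by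
      rw [Real.exp_le_one_iff]
      linarith [mul_nonneg hl0.le hp.1]
    calc N ≤ Real.exp (-(l * p)) * ((R + (a + b * R) * S) + Real.exp (l * p) * (N / 2)) :=
          mul_le_mul_of_nonneg_left h1 (Real.exp_pos _).le
      _ = Real.exp (-(l * p)) * (R + (a + b * R) * S) +
          Real.exp (-(l * p) + l * p) * (N / 2) := by rw [Real.exp_add]; ring
      _ ≤ 1 * (R + (a + b * R) * S) + 1 * (N / 2) := by
          rw [neg_add_cancel, Real.exp_zero]
          gcongr
      _ = _ := by ring
  have hNN₀ : N ≤ N₀ := by linarith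
  refine (hgrowth _).trans ?_
  have : ‖history r w t‖ ≤ R + Real.exp (l * S) * N₀ := by
    refine (hhist t ht).trans ?_
    have : l * t ≤ l * S := mul_le_mul_of_nonneg_left (ht.2.trans hTS) hl0.le
    gcongr
  gcongr

omit [NormedSpace ℝ H] [CompleteSpace H] in
-- For t + θ ≤ 0 uniform continuity compares φ(t + θ) with φ(θ); otherwise θ lies within t of 0, and
-- it compares φ(0) with φ(θ).
theorem exists_norm_history_sub_le (φ : PhaseSpace r H) {σ : ℝ} (hσ : 0 < σ) :
    ∃ h > 0, ∀ (w : C(ℝ, H)) (t : ℝ), t ∈ Icc 0 h →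
      (∀ θ : Icc (-(r : ℝ)) 0, ‖w θ - φ θ‖ ≤ σ / 2) →
      (∀ s ∈ Icc 0 t, ‖w s - φ (zeroPt r)‖ ≤ σ / 2) → ‖history r w t - φ‖ ≤ σ := by
  have huc := CompactSpace.uniformContinuous_of_continuous φ.continuous
  obtain ⟨δ, hδ, hφ⟩ := Metric.uniformContinuous_iff.1 huc (σ / 2) (half_pos hσ)
  refine ⟨δ / 2, half_pos hδ, fun w t ht h0 h => ?_⟩
  refine (ContinuousMap.norm_le _ hσ.le).2 fun θ => ?_
  rw [ContinuousMap.sub_apply, history_apply]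
  rcases le_total (t + θ) 0 with hθ | hθ
  · let θ' : Icc (-(r : ℝ)) 0 := ⟨t + θ, by linarith [θ.2.1, ht.1], hθ⟩
    have h1 := h0 θ'
    have h2 : dist (φ θ') (φ θ) < σ / 2 := hφ (by
      rw [Subtype.dist_eq, Real.dist_eq]
      change |t + (θ : ℝ) - θ| < δ
      rw [add_sub_cancel_right, abs_of_nonneg ht.1]
      linarith [ht.2])
    rw [dist_eq_norm] at h2
    have h3 : w (t + θ) - φ θ = (w θ' - φ θ') + (φ θ' - φ θ) := by
      change w (t + θ) - φ θ = (w (t + θ) - φ θ') + (φ θ' - φ θ)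
      abel
    rw [h3]
    exact (norm_add_le _ _).trans (by linarith)
  · have h1 := h (t + θ) ⟨hθ, by linarith [θ.2.2]⟩
    have h2 : dist (φ (zeroPt r)) (φ θ) < σ / 2 := hφ (by
      rw [Subtype.dist_eq, Real.dist_eq, zeroPt_coe, zero_sub, abs_neg, abs_lt]
      constructor <;> linarith [ht.2, θ.2.2])
    rw [dist_eq_norm] at h2
    have h3 : w (t + θ) - φ θ = (w (t + θ) - φ (zeroPt r)) + (φ (zeroPt r) - φ θ) := by abel
    rw [h3]
    exact (norm_add_le _ _).trans (by linarith)

end MildTheory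


/-! ### Local stability, uniqueness and local existence -/

section MildTheory

variable {H : Type*} [NormedAddCommGroup H] {r : ℝ≥0}

/-- Near each state `φ`, the nonlinearity depends in a Lipschitz way on the histories of curves
that issue from `φ`, up to an error that vanishes with the distance of the initial states. -/
def IsLocallyControlled (G : PhaseSpace r H → H) : Prop :=
  ∀ φ : PhaseSpace r H, ∃ σ > 0, ∃ δ > 0, ∃ K : ℝ, 0 ≤ K ∧ ∀ T ≤ δ, ∀ u : C(ℝ, H),
    (∀ θ : Icc (-(r : ℝ)) 0, u θ = φ θ) → (∀ s ∈ Icc 0 T, ‖history r u s - φ‖ ≤ σ) →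
    ∀ ε > 0, ∃ γ > 0, ∀ w : C(ℝ, H), (∀ θ : Icc (-(r : ℝ)) 0, ‖w θ - φ θ‖ ≤ γ) →
      (∀ s ∈ Icc 0 T, ‖history r w s - φ‖ ≤ σ) → ∀ s ∈ Icc 0 T,
        ‖G (history r w s) - G (history r u s)‖ ≤ K * ‖history r w s - history r u s‖ + ε

/-- With equal initial functions every `γ` is admissible, so ε can tend to 0. -/
theorem IsLocallyControlled.lipschitz_of_eq {G : PhaseSpace r H → H}
    (hG : IsLocallyControlled G) (φ : PhaseSpace r H) :
    ∃ σ > 0, ∃ δ > 0, ∃ K : ℝ, 0 ≤ K ∧ ∀ T ≤ δ, ∀ u w : C(ℝ, H),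
      (∀ θ : Icc (-(r : ℝ)) 0, u θ = φ θ) → (∀ θ : Icc (-(r : ℝ)) 0, w θ = φ θ) →
      (∀ s ∈ Icc 0 T, ‖history r u s - φ‖ ≤ σ) → (∀ s ∈ Icc 0 T, ‖history r w s - φ‖ ≤ σ) →
      ∀ s ∈ Icc 0 T,
        ‖G (history r w s) - G (history r u s)‖ ≤ K * ‖history r w s - history r u s‖ := by
  obtain ⟨σ, hσ, δ, hδ, K, hK, h⟩ := hG φ
  refine ⟨σ, hσ, δ, hδ, K, hK, fun T hT u w hu hw hu' hw' s hs => ?_⟩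
  refine le_of_forall_pos_le_add fun ε hε => ?_
  obtain ⟨γ, hγ, h2⟩ := h T hT u hu hu' ε hε
  exact h2 w (fun θ => by rw [hw, sub_self, norm_zero]; exact hγ.le) hw' s hs

variable [NormedSpace ℝ H]
variable {E : ℝ → H →L[ℝ] H} {G : PhaseSpace r H → H} {φ ψ : PhaseSpace r H} {T : ℝ}
  {w v : C(ℝ, H)}

theorem IsContractionSemigroup.exists_norm_apply_sub_le (hE : IsContractionSemigroup E) (x : H)
    {ε : ℝ} (hε : 0 < ε) : ∃ h > 0, ∀ t ∈ Icc 0 h, ‖E t x - x‖ ≤ ε := by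
  obtain ⟨δ, hδ, h⟩ := Metric.continuous_iff.1 (hE.continuous_apply x) 0 ε hε
  refine ⟨δ / 2, half_pos hδ, fun t ht => ?_⟩
  have := h t (by rw [Real.dist_eq, sub_zero, abs_of_nonneg ht.1]; linarith [ht.2])
  rw [hE.apply_zero, dist_eq_norm] at this
  exact this.le

theorem IsMild.norm_history_sub_initial_le (hE : IsContractionSemigroup E) (φ : PhaseSpace r H)
    {σ M : ℝ} (hσ : 0 < σ) (hM : 0 ≤ M) :
    ∃ h > 0, ∀ (ψ : PhaseSpace r H) (w : C(ℝ, H)) (T : ℝ), ‖ψ - φ‖ ≤ h → T ≤ h →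
      IsMild E G ψ T w → (∀ t ∈ Icc 0 T, ‖G (history r w t)‖ ≤ M) →
      ∀ t ∈ Icc 0 T, ‖history r w t - φ‖ ≤ σ := by
  obtain ⟨h₁, hh₁, H₁⟩ := exists_norm_history_sub_le φ hσ
  obtain ⟨h₂, hh₂, H₂⟩ := hE.exists_norm_apply_sub_le (φ (zeroPt r)) (by positivity : 0 < σ / 8)
  refine ⟨min (min h₁ h₂) (min (σ / 8) (σ / (8 * (M + 1)))), by positivity, ?_⟩
  intro ψ w T hψ hT hw hMw t ht
  simp only [le_min_iff] at hψ hT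
  obtain ⟨⟨hT1, hT2⟩, hT3, hT4⟩ := hT
  obtain ⟨-, hψ3, -⟩ := hψ
  have hpt : ∀ θ, ‖ψ θ - φ θ‖ ≤ σ / 8 := fun θ =>
    (ContinuousMap.norm_coe_le_norm (ψ - φ) θ).trans hψ3
  refine H₁ w t ⟨ht.1, ht.2.trans hT1⟩ (fun θ => ?_) fun s hs => ?_
  · rw [hw.1]
    exact (hpt θ).trans (by linarith)
  · have hsT : s ≤ T := hs.2.trans ht.2
    have h1 : ‖∫ x in (0 : ℝ)..s, E (s - x) (G (history r w x))‖ ≤ M * s :=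
      hE.norm_convolution_le hs.1 fun x hx => hMw x ⟨hx.1, hx.2.trans hsT⟩
    have h2 : M * s ≤ σ / 8 := by
      have : s ≤ σ / (8 * (M + 1)) := hsT.trans hT4
      rw [le_div_iff₀ (by positivity)] at this
      nlinarith [hs.1]
    have h3 := H₂ s ⟨hs.1, hsT.trans hT2⟩
    have h4 : ‖E s (ψ (zeroPt r)) - E s (φ (zeroPt r))‖ ≤ σ / 8 := by
      rw [← map_sub]
      exact (hE.norm_apply_le _ _).trans (hpt _)
    rw [hw.2 s ⟨hs.1, hsT⟩]
    have h5 : E s (ψ (zeroPt r)) + (∫ x in (0 : ℝ)..s, E (s - x) (G (history r w x))) -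
        φ (zeroPt r) = (E s (ψ (zeroPt r)) - E s (φ (zeroPt r))) +
        (E s (φ (zeroPt r)) - φ (zeroPt r)) +
        ∫ x in (0 : ℝ)..s, E (s - x) (G (history r w x)) := by abel
    rw [h5]
    refine (norm_add₃_le).trans ?_
    linarith

/-- Standing assumptions on a mild Cauchy problem with delay. -/
structure IsAdmissible (E : ℝ → H →L[ℝ] H) (G : PhaseSpace r H → H) : Prop where
  semigroup : IsContractionSemigroup E
  continuous : Continuous G
  growth : ∃ a b : ℝ, 0 ≤ a ∧ 0 ≤ b ∧ ∀ χ, ‖G χ‖ ≤ a + b * ‖χ‖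
  controlled : IsLocallyControlled G

theorem IsAdmissible.exists_bound (h : IsAdmissible E G) {S R : ℝ} (hS : 0 ≤ S) (hR : 0 ≤ R) :
    ∃ M, 0 ≤ M ∧ ∀ (φ : PhaseSpace r H) (w : C(ℝ, H)) (T : ℝ), ‖φ‖ ≤ R → T ≤ S →
      IsMild E G φ T w → ∀ t ∈ Icc 0 T, ‖G (history r w t)‖ ≤ M := by
  obtain ⟨a, b, ha, hb, hg⟩ := h.growth
  exact exists_norm_le_of_isMild h.semigroup ha hb hg hS hR

/-- The time `δ` is chosen before `u` and `ε`, with K δ ≤ 1/2, so that the Lipschitz term is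
absorbed into the maximal distance `D` of the two solutions. -/
theorem IsAdmissible.local_stability (h : IsAdmissible E G) (φ : PhaseSpace r H) :
    ∃ δ > 0, ∀ T ∈ Icc 0 δ, ∀ u, IsMild E G φ T u → ∀ ε > 0, ∃ γ > 0,
      ∀ (ψ : PhaseSpace r H) (w : C(ℝ, H)), ‖ψ - φ‖ ≤ γ → IsMild E G ψ T w →
        ∀ t ∈ Icc 0 T, ‖history r w t - history r u t‖ ≤ ε := by
  obtain ⟨σ, hσ, δ, hδ, K, hK, hctrl⟩ := h.controlled φ
  obtain ⟨M, hM, hbound⟩ := h.exists_bound zero_le_one (by positivity : 0 ≤ ‖φ‖ + 1)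
  obtain ⟨h₀, hh₀, hclose⟩ := IsMild.norm_history_sub_initial_le (G := G) h.semigroup φ hσ hM
  refine ⟨min (min h₀ δ) (min 1 (1 / (2 * (K + 1)))), by positivity, ?_⟩
  intro T hT u hu ε hε
  simp only [mem_Icc, le_min_iff] at hT
  obtain ⟨hT0, ⟨hT1, hT2⟩, hT3, hT4⟩ := hT
  have hKT : K * T ≤ 1 / 2 := by
    rw [le_div_iff₀ (by positivity)] at hT4
    nlinarith
  have hMu := hbound φ u T (by linarith) hT3 hu
  have hu' := hclose φ u T (by rw [sub_self, norm_zero]; exact hh₀.le) hT1 hu hMu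
  obtain ⟨γ₀, hγ₀, hγ⟩ := hctrl T hT2 u hu.1 hu' (ε / 4) (by positivity)
  -- Absorption yields D ≤ 3‖ψ - φ‖ + ε/2, so histories differ by at most 4‖ψ - φ‖ + ε/2.
  refine ⟨min (min γ₀ h₀) (min 1 (ε / 8)), by positivity, ?_⟩
  intro ψ w hψ hw t ht
  simp only [le_min_iff] at hψ
  obtain ⟨⟨hψ1, hψ2⟩, hψ3, hψ4⟩ := hψ
  have hψn : ‖ψ‖ ≤ ‖φ‖ + 1 := by
    have := norm_sub_norm_le ψ φ
    linarith
  have hw' := hclose ψ w T hψ2 hT1 hw (hbound ψ w T hψn hT3 hw)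
  have hpt : ∀ θ : Icc (-(r : ℝ)) 0, ‖w θ - φ θ‖ ≤ ‖ψ - φ‖ := fun θ => by
    rw [hw.1]; exact ContinuousMap.norm_coe_le_norm (ψ - φ) θ
  have hG := hγ w (fun θ => (hpt θ).trans hψ1) hw'
  obtain ⟨p, hp, hmax⟩ := isCompact_Icc.exists_isMaxOn (nonempty_Icc.2 hT0)
    (f := fun t => ‖w t - u t‖) (by fun_prop)
  set D : ℝ := ‖w p - u p‖ with hD
  have hDle : ∀ s ∈ Icc 0 T, ‖w s - u s‖ ≤ D := fun s hs => hmax hs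
  have hD0 : 0 ≤ D := norm_nonneg _
  have hhist : ∀ s ∈ Icc 0 T, ‖history r w s - history r u s‖ ≤ ‖ψ - φ‖ + D := fun s hs => by
    refine norm_history_sub_le hs.1 (fun θ => ?_) fun x hx => ?_
    · rw [hu.1]
      exact (hpt θ).trans (le_add_of_nonneg_right hD0)
    · exact (hDle x ⟨hx.1, hx.2.trans hs.2⟩).trans (le_add_of_nonneg_left (norm_nonneg _))
  have hDD := IsMild.norm_sub_le h.semigroup h.continuous (M := K * (‖ψ - φ‖ + D) + ε / 4) hw hu hp
    fun s hs => by
      have hs' : s ∈ Icc 0 T := ⟨hs.1, hs.2.trans hp.2⟩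
      refine (hG s hs').trans ?_
      have := mul_le_mul_of_nonneg_left (hhist s hs') hK
      linarith
  have hKp : K * p ≤ 1 / 2 := (mul_le_mul_of_nonneg_left hp.2 hK).trans hKT
  have h1 : (K * (‖ψ - φ‖ + D) + ε / 4) * p ≤ (‖ψ - φ‖ + D) / 2 + ε / 4 := by
    have h2 : K * p * (‖ψ - φ‖ + D) ≤ 1 / 2 * (‖ψ - φ‖ + D) :=
      mul_le_mul_of_nonneg_right hKp (by positivity)
    have h3 : ε / 4 * p ≤ ε / 4 * 1 :=
      mul_le_mul_of_nonneg_left (hp.2.trans hT3) (by positivity)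
    linarith
  refine (hhist t ht).trans ?_
  linarith

/-- Uniqueness is local stability with ψ = φ and arbitrary ε, restarted at each time of agreement;
agreement passes to left limits by continuity. -/
theorem IsAdmissible.history_eq [CompleteSpace H] (h : IsAdmissible E G)
    (hw : IsMild E G φ T w)
    (hv : IsMild E G φ T v) {t : ℝ} (ht : t ∈ Icc 0 T) : history r w t = history r v t := by
  suffices ∀ t, 0 ≤ t → (t ≤ T → history r w t = history r v t) from this t ht.1 ht.2
  refine real_induction (fun _ => ?_) (fun t ht0 hP => ?_) fun t ht0 hP htT => ?_
  · rw [history_zero_eq hw.1, history_zero_eq hv.1]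
  · obtain ⟨δ, hδ, hst⟩ := h.local_stability (history r w t)
    refine ⟨δ, hδ, fun s hs hsT => ?_⟩
    have htT : t ≤ T := hs.1.trans hsT
    have hst0 : 0 ≤ s - t := sub_nonneg.2 hs.1
    have hts : t + (s - t) ≤ T := by linarith
    have hw' := (hw.mono hts).translate_of_add h.semigroup h.continuous ht0 hst0
    have hv' := (hv.mono hts).translate_of_add h.semigroup h.continuous ht0 hst0
    rw [← hP htT] at hv'
    have key : history r (translate t v) (s - t) = history r (translate t w) (s - t) := by
      rw [← sub_eq_zero, ← norm_le_zero_iff]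
      refine le_of_forall_pos_le_add fun ε hε => ?_
      obtain ⟨γ, hγ, H⟩ := hst (s - t) ⟨hst0, by linarith [hs.2]⟩ _ hw' ε hε
      rw [zero_add]
      exact H _ _ (by rw [sub_self, norm_zero]; exact hγ.le) hv' _ ⟨hst0, le_rfl⟩
    rw [history_translate, history_translate, add_sub_cancel] at key
    exact key.symm
  · have hl : ∀ w : C(ℝ, H), Tendsto (fun s => history r w s) (𝓝[<] t) (𝓝 (history r w t)) :=
      fun w => ((continuous_history w).tendsto t).mono_left nhdsWithin_le_nhds
    refine tendsto_nhds_unique_of_eventuallyEq (hl w) (hl v) ?_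
    filter_upwards [Ioo_mem_nhdsLT ht0] with s hs
    exact hP s ⟨hs.1.le, hs.2⟩ (hs.2.le.trans htT)

theorem IsAdmissible.eqOn [CompleteSpace H] (h : IsAdmissible E G) (hw : IsMild E G φ T w)
    (hv : IsMild E G φ T v) : ∀ x ∈ Icc (-(r : ℝ)) T, w x = v x := by
  intro x hx
  rcases le_total x 0 with hx0 | hx0
  · exact hw.eq_of_nonpos hv ⟨hx.1, hx0⟩
  · rw [← history_zeroPt (r := r) w, h.history_eq hw hv ⟨hx0, hx.2⟩, history_zeroPt]

/-- The curve that starts with `φ` and continues with `φ 0 + y t - y 0` on `[0, h]`. -/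
noncomputable def attach (φ : PhaseSpace r H) {h : ℝ} (hh : 0 ≤ h) (y : C(Icc (0 : ℝ) h, H)) : C(ℝ, H) :=
  φ.IccExtend (neg_nonpos.2 r.coe_nonneg) + y.IccExtend hh - ContinuousMap.const ℝ (y ⟨0, le_rfl, hh⟩)

omit [NormedSpace ℝ H] in
theorem attach_of_nonpos {h : ℝ} (hh : 0 ≤ h) (y : C(Icc (0 : ℝ) h, H))
    (θ : Icc (-(r : ℝ)) 0) : attach φ hh y θ = φ θ := by
  have h1 : y.IccExtend hh θ = y ⟨0, le_rfl, hh⟩ := by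
    rw [ContinuousMap.coe_IccExtend, IccExtend_of_le_left _ _ θ.2.2]
  have h2 : φ.IccExtend (neg_nonpos.2 r.coe_nonneg) θ = φ θ := by
    rw [ContinuousMap.coe_IccExtend, IccExtend_of_mem _ _ θ.2]
  simp only [attach, ContinuousMap.sub_apply, ContinuousMap.add_apply, ContinuousMap.const_apply,
    h1, h2, add_sub_cancel_right]

omit [NormedSpace ℝ H] in
theorem attach_of_mem {h : ℝ} (hh : 0 ≤ h) (y : C(Icc (0 : ℝ) h, H)) {t : ℝ}
    (ht : t ∈ Icc 0 h) :
    attach φ hh y t = φ (zeroPt r) + y ⟨t, ht⟩ - y ⟨0, le_rfl, hh⟩ := by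
  have h1 : y.IccExtend hh t = y ⟨t, ht⟩ := by
    rw [ContinuousMap.coe_IccExtend, IccExtend_of_mem _ _ ht]
  have h2 : φ.IccExtend (neg_nonpos.2 r.coe_nonneg) t = φ (zeroPt r) := by
    rw [ContinuousMap.coe_IccExtend, IccExtend_of_right_le _ _ ht.1]
    rfl
  simp only [attach, ContinuousMap.sub_apply, ContinuousMap.add_apply, ContinuousMap.const_apply,
    h1, h2]

theorem IsAdmissible.exists_isMild_local [CompleteSpace H] (h : IsAdmissible E G)
    (φ : PhaseSpace r H) :
    ∃ δ > 0, ∃ w, IsMild E G φ δ w := by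
  obtain ⟨σ, hσ, δ, hδ, K, hK, hlip⟩ := h.controlled.lipschitz_of_eq φ
  obtain ⟨a, b, ha, hb, hgrowth⟩ := h.growth
  set M : ℝ := a + b * (‖φ‖ + σ) with hMdef
  have hM : 0 ≤ M := by positivity
  obtain ⟨h₁, hh₁, H₁⟩ := exists_norm_history_sub_le φ hσ
  obtain ⟨h₂, hh₂, H₂⟩ :=
    h.semigroup.exists_norm_apply_sub_le (φ (zeroPt r)) (by positivity : 0 < σ / 8)
  -- Attached curves involve y t - y 0, which doubles distances: K τ ≤ 1/4 gives contraction factor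
  -- 1/2, and the radius σ/4 below keeps curves within σ/2 of φ(0).
  obtain ⟨τ, hτ, hτ1, hτ2, hτδ, hτM, hτK⟩ : ∃ τ > 0, τ ≤ h₁ ∧ τ ≤ h₂ ∧ τ ≤ δ ∧ M * τ ≤ σ / 8 ∧
      K * τ ≤ 1 / 4 := by
    refine ⟨min (min h₁ h₂) (min δ (min (σ / (8 * (M + 1))) (1 / (4 * (K + 1))))), by positivity,
      (min_le_left _ _).trans (min_le_left _ _), (min_le_left _ _).trans (min_le_right _ _),
      (min_le_right _ _).trans (min_le_left _ _), ?_, ?_⟩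
    · have : min (min h₁ h₂) (min δ (min (σ / (8 * (M + 1))) (1 / (4 * (K + 1))))) ≤
        σ / (8 * (M + 1)) :=
        (min_le_right _ _).trans ((min_le_right _ _).trans (min_le_left _ _))
      refine (mul_le_mul_of_nonneg_left this hM).trans ?_
      rw [← mul_div_assoc, div_le_div_iff₀ (by positivity) (by positivity)]
      nlinarith
    · have : min (min h₁ h₂) (min δ (min (σ / (8 * (M + 1))) (1 / (4 * (K + 1))))) ≤
        1 / (4 * (K + 1)) :=
        (min_le_right _ _).trans ((min_le_right _ _).trans (min_le_right _ _))
      refine (mul_le_mul_of_nonneg_left this hK).trans ?_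
      rw [← mul_div_assoc, div_le_div_iff₀ (by positivity) (by positivity)]
      nlinarith
  -- Since `attach` subtracts y 0, every y gives a continuous curve and the fixed point is sought in
  -- a full ball; it satisfies y 0 = 0 automatically.
  let W : C(Icc (0 : ℝ) τ, H) → C(ℝ, H) := attach φ hτ.le
  let Φ : C(Icc (0 : ℝ) τ, H) → C(Icc (0 : ℝ) τ, H) := fun y =>
    { toFun := fun t => E t (φ (zeroPt r)) - φ (zeroPt r) +
        ∫ s in (0 : ℝ)..t, E (t - s) (G (history r (W y) s))
      continuous_toFun := by
        have h1 := h.semigroup.continuous_apply (φ (zeroPt r))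
        have h2 := h.semigroup.continuous_convolution (continuous_comp_history h.continuous (W y))
        exact ((h1.sub continuous_const).add h2).comp continuous_subtype_val }
  have hΦ : ∀ y t, Φ y t = E t (φ (zeroPt r)) - φ (zeroPt r) +
        ∫ s in (0 : ℝ)..t, E (t - s) (G (history r (W y) s)) := fun y t => rfl
  set B : Set C(Icc (0 : ℝ) τ, H) := Metric.closedBall 0 (σ / 4) with hB
  have hBnorm : ∀ y ∈ B, ‖y‖ ≤ σ / 4 := fun y hy => by rwa [hB, mem_closedBall_zero_iff] at hy
  have hnear : ∀ y ∈ B, ∀ s ∈ Icc 0 τ, ‖history r (W y) s - φ‖ ≤ σ := fun y hy s hs => by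
    refine H₁ (W y) s ⟨hs.1, hs.2.trans hτ1⟩ (fun θ => ?_) fun x hx => ?_
    · rw [attach_of_nonpos, sub_self, norm_zero]
      positivity
    · rw [attach_of_mem hτ.le y ⟨hx.1, hx.2.trans hs.2⟩, add_sub_assoc, add_sub_cancel_left]
      refine (norm_sub_le _ _).trans ?_
      linarith [y.norm_coe_le_norm ⟨x, hx.1, hx.2.trans hs.2⟩, y.norm_coe_le_norm ⟨0, le_rfl, hτ.le⟩,
        hBnorm y hy]
  have hmaps : MapsTo Φ B B := fun y hy => by
    rw [hB, mem_closedBall_zero_iff, ContinuousMap.norm_le _ (by positivity)]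
    intro t
    have h1 := H₂ t ⟨t.2.1, t.2.2.trans hτ2⟩
    have h2 : ‖∫ s in (0 : ℝ)..t, E (t - s) (G (history r (W y) s))‖ ≤ M * t :=
      h.semigroup.norm_convolution_le t.2.1 fun s hs => by
        refine (hgrowth _).trans ?_
        have h3 := hnear y hy s ⟨hs.1, hs.2.trans t.2.2⟩
        have h4 := norm_sub_norm_le (history r (W y) s) φ
        have h5 : ‖history r (W y) s‖ ≤ ‖φ‖ + σ := by linarith
        rw [hMdef]
        gcongr
    have h3 : M * t ≤ M * τ := mul_le_mul_of_nonneg_left t.2.2 hM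
    rw [hΦ]
    exact (norm_add_le _ _).trans (by linarith)
  have hcontr : ∀ y ∈ B, ∀ z ∈ B, ‖Φ y - Φ z‖ ≤ 1 / 2 * ‖y - z‖ := fun y hy z hz => by
    rw [ContinuousMap.norm_le _ (by positivity)]
    intro t
    have hi : ∀ w : C(ℝ, H), IntervalIntegrable
        (fun s => E (t - s) (G (history r w s))) volume 0 t := fun w =>
      (h.semigroup.continuous_convolution_integrand
        (continuous_comp_history h.continuous w) t).intervalIntegrable _ _
    rw [ContinuousMap.sub_apply, hΦ, hΦ, add_sub_add_left_eq_sub,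
      ← intervalIntegral.integral_sub (hi _) (hi _)]
    simp only [← map_sub]
    have h1 : ‖∫ s in (0 : ℝ)..t, E (t - s) (G (history r (W y) s) - G (history r (W z) s))‖ ≤
        K * (2 * ‖y - z‖) * t := by
      refine h.semigroup.norm_convolution_le t.2.1 fun s hs => ?_
      have hs' : s ∈ Icc 0 τ := ⟨hs.1, hs.2.trans t.2.2⟩
      refine (hlip τ hτδ (W z) (W y) (attach_of_nonpos _ _) (attach_of_nonpos _ _)
        (hnear z hz) (hnear y hy) s hs').trans (mul_le_mul_of_nonneg_left ?_ hK)
      refine norm_history_sub_le hs.1 (fun θ => ?_) fun x hx => ?_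
      · rw [attach_of_nonpos, attach_of_nonpos, sub_self, norm_zero]
        positivity
      · have hx' : x ∈ Icc 0 τ := ⟨hx.1, hx.2.trans hs'.2⟩
        rw [attach_of_mem hτ.le y hx', attach_of_mem hτ.le z hx']
        have : φ (zeroPt r) + y ⟨x, hx'⟩ - y ⟨0, le_rfl, hτ.le⟩ -
            (φ (zeroPt r) + z ⟨x, hx'⟩ - z ⟨0, le_rfl, hτ.le⟩) =
            (y - z) ⟨x, hx'⟩ - (y - z) ⟨0, le_rfl, hτ.le⟩ := by
          simp only [ContinuousMap.sub_apply]
          abel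
        rw [this]
        refine (norm_sub_le _ _).trans ?_
        linarith [(y - z).norm_coe_le_norm ⟨x, hx'⟩, (y - z).norm_coe_le_norm ⟨0, le_rfl, hτ.le⟩]
    refine h1.trans ?_
    have h2 : K * t ≤ 1 / 4 := (mul_le_mul_of_nonneg_left t.2.2 hK).trans hτK
    nlinarith [norm_nonneg (y - z)]
  have hcw : ContractingWith (1 / 2) (hmaps.restrict Φ B B) := by
    refine ⟨by norm_num, LipschitzWith.of_dist_le_mul fun y z => ?_⟩
    rw [Subtype.dist_eq, Subtype.dist_eq, dist_eq_norm, dist_eq_norm]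
    simpa using hcontr y y.2 z z.2
  obtain ⟨y, hyB, hfix, -⟩ := hcw.exists_fixedPoint' Metric.isClosed_closedBall.isComplete hmaps
    (x := 0) (by rw [hB, mem_closedBall_zero_iff, norm_zero]; positivity) (edist_ne_top _ _)
  have hy : ∀ t : Icc (0 : ℝ) τ, y t = E t (φ (zeroPt r)) - φ (zeroPt r) +
      ∫ s in (0 : ℝ)..t, E (t - s) (G (history r (W y) s)) := fun t => by
    rw [← hΦ, hfix.eq]
  have hy0 : y ⟨0, le_rfl, hτ.le⟩ = 0 := by
    rw [hy]
    simp [h.semigroup.apply_zero]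
  refine ⟨τ, hτ, W y, attach_of_nonpos _ _, fun t ht => ?_⟩
  rw [attach_of_mem hτ.le y ht, hy0, hy]
  abel

end MildTheory


/-! ### Global existence, continuous dependence and the dynamical system -/

section MildTheory

variable {H : Type*} [NormedAddCommGroup H] [NormedSpace ℝ H] [CompleteSpace H] {r : ℝ≥0}
variable {E : ℝ → H →L[ℝ] H} {G : PhaseSpace r H → H} {φ ψ : PhaseSpace r H} {T : ℝ}
  {w v : C(ℝ, H)}

open Classical in
/-- The common extension of all mild solutions with initial function `φ`; it takes the value `0` at
times that no mild solution reaches. -/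
noncomputable def commonExtension (E : ℝ → H →L[ℝ] H) (G : PhaseSpace r H → H)
    (φ : PhaseSpace r H) (x : ℝ) : H :=
  if h : ∃ w, IsMild E G φ (max x 0) w then h.choose (max x (-(r : ℝ))) else 0

theorem IsAdmissible.commonExtension_eq (h : IsAdmissible E G) (hT : 0 ≤ T)
    (hw : IsMild E G φ T w) {x : ℝ} (hx : x ≤ T) :
    commonExtension E G φ x = w (max x (-(r : ℝ))) := by
  have hex : ∃ w, IsMild E G φ (max x 0) w := ⟨w, hw.mono (max_le hx hT)⟩
  rw [commonExtension, dif_pos hex]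
  exact h.eqOn hex.choose_spec (hw.mono (max_le hx hT)) _
    ⟨le_max_right _ _, max_le_max le_rfl (neg_nonpos.2 r.coe_nonneg)⟩

theorem IsAdmissible.continuousAt_commonExtension (h : IsAdmissible E G) (hT : 0 ≤ T)
    (hw : IsMild E G φ T w) {x : ℝ} (hx : x < T) : ContinuousAt (commonExtension E G φ) x := by
  have hc : ContinuousAt (fun x => w (max x (-(r : ℝ)))) x := by fun_prop
  refine hc.congr ?_
  filter_upwards [Iio_mem_nhds hx] with y hy
  exact (h.commonExtension_eq hT hw (le_of_lt hy)).symm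

/-- On (a, T) the solution stays within M(T - a) of the free evolution from time `a`, which is
continuous at `T`. With `a` close to `T` this is the Cauchy criterion. -/
theorem IsAdmissible.exists_tendsto_commonExtension (h : IsAdmissible E G) (hT : 0 < T)
    (hex : ∀ s ∈ Ico 0 T, ∃ w, IsMild E G φ s w) :
    ∃ l, Tendsto (commonExtension E G φ) (𝓝[<] T) (𝓝 l) := by
  obtain ⟨M, hM, hbound⟩ := h.exists_bound hT.le (norm_nonneg φ)
  rw [← cauchy_map_iff_exists_tendsto, Metric.cauchy_iff]
  refine ⟨inferInstance, fun ε hε => ?_⟩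
  set a : ℝ := max 0 (T - ε / (4 * (M + 1))) with ha
  have ha0 : 0 ≤ a := le_max_left _ _
  have haT : a < T := max_lt hT (sub_lt_self _ (by positivity))
  have haε : M * (T - a) ≤ ε / 4 := by
    have h1 : T - a ≤ ε / (4 * (M + 1)) := by linarith [le_max_right 0 (T - ε / (4 * (M + 1)))]
    rw [le_div_iff₀ (by positivity)] at h1
    nlinarith
  set p : H := commonExtension E G φ a
  have hc : ContinuousAt (fun x => E (x - a) p) T :=
    ((h.semigroup.continuous_apply p).comp (continuous_id.sub continuous_const)).continuousAt
  obtain ⟨δ, hδ, hδ'⟩ := Metric.continuousAt_iff.1 hc (ε / 4) (by positivity)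
  have key : ∀ x ∈ Ioo (max a (T - δ)) T,
      ‖commonExtension E G φ x - E (T - a) p‖ < ε / 2 := fun x hx => by
    have hax : a < x := (le_max_left _ _).trans_lt hx.1
    obtain ⟨w, hw⟩ := hex x ⟨ha0.trans hax.le, hx.2⟩
    have hx0 : 0 ≤ x := ha0.trans hax.le
    have hr := neg_nonpos.2 r.coe_nonneg
    have h1 : commonExtension E G φ x = w x := by
      rw [h.commonExtension_eq hx0 hw le_rfl, max_eq_left (hr.trans hx0)]
    have h2 : p = w a := by
      rw [← max_eq_left (hr.trans ha0)]
      exact h.commonExtension_eq hx0 hw hax.le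
    have h3 := hw.norm_sub_apply_le h.semigroup h.continuous ha0 hax.le le_rfl
      (hbound φ w x le_rfl hx.2.le hw)
    rw [← h1, ← h2] at h3
    have h4 : M * (x - a) ≤ M * (T - a) := mul_le_mul_of_nonneg_left (by linarith [hx.2]) hM
    have h5 := hδ' (x := x) (by
      rw [Real.dist_eq, abs_lt]
      constructor <;> linarith [hx.2, (le_max_right a (T - δ)).trans_lt hx.1])
    rw [dist_eq_norm] at h5
    have h6 : commonExtension E G φ x - E (T - a) p =
        (commonExtension E G φ x - E (x - a) p) + (E (x - a) p - E (T - a) p) := by abel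
    rw [h6]
    exact (norm_add_le _ _).trans_lt (by linarith)
  refine ⟨commonExtension E G φ '' Ioo (max a (T - δ)) T,
    image_mem_map (Ioo_mem_nhdsLT (max_lt haT (sub_lt_self _ hδ))), ?_⟩
  rintro _ ⟨x, hx, rfl⟩ _ ⟨y, hy, rfl⟩
  refine (dist_triangle_right _ _ (E (T - a) p)).trans_lt ?_
  rw [dist_eq_norm, dist_eq_norm]
  linarith [key x hx, key y hy]

theorem IsAdmissible.exists_isMild_of_forall_lt (h : IsAdmissible E G) (hT : 0 < T)
    (hex : ∀ s ∈ Ico 0 T, ∃ w, IsMild E G φ s w) : ∃ w, IsMild E G φ T w := by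
  obtain ⟨l, hl⟩ := h.exists_tendsto_commonExtension hT hex
  have hcont : Continuous fun x => if x < T then commonExtension E G φ x else l := by
    rw [continuous_iff_continuousAt]
    intro x
    rcases lt_trichotomy x T with hx | rfl | hx
    · obtain ⟨y, hy, hyT⟩ := exists_between (max_lt hx hT)
      obtain ⟨w, hw⟩ := hex y ⟨(le_max_right _ _).trans hy.le, hyT⟩
      refine (h.continuousAt_commonExtension ((le_max_right _ _).trans hy.le) hw
        ((le_max_left _ _).trans_lt hy)).congr ?_
      filter_upwards [Iio_mem_nhds hx] with z hz
      exact (if_pos hz).symm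
    · rw [continuousAt_iff_continuous_left'_right']
      simp only [ContinuousWithinAt, lt_irrefl, if_false]
      constructor
      · refine hl.congr' ?_
        filter_upwards [self_mem_nhdsWithin] with z hz
        exact (if_pos hz).symm
      · refine tendsto_const_nhds.congr' ?_
        filter_upwards [self_mem_nhdsWithin] with z hz
        exact (if_neg (not_lt.2 (le_of_lt hz))).symm
    · refine (continuousAt_const (y := l)).congr ?_
      filter_upwards [Ioi_mem_nhds hx] with z hz
      exact (if_neg (not_lt.2 (le_of_lt hz))).symm
  let u : C(ℝ, H) := ⟨_, hcont⟩
  have hmild : ∀ s ∈ Ico 0 T, IsMild E G φ s u := fun s hs => by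
    obtain ⟨w, hw⟩ := hex s hs
    refine hw.congr hs.1 fun x hx => ?_
    change _ = if x < T then _ else _
    rw [if_pos (hx.2.trans_lt hs.2), h.commonExtension_eq hs.1 hw hx.2, max_eq_left hx.1]
  refine ⟨u, (hmild 0 ⟨le_rfl, hT⟩).1, fun t ht => ?_⟩
  rcases ht.2.lt_or_eq with htT | rfl
  -- Before `T` the equation is known; at `T` itself it follows because both sides are continuous.
  · exact (hmild t ⟨ht.1, htT⟩).2 t ⟨ht.1, le_rfl⟩
  · have hc1 : Continuous fun t => E t (φ (zeroPt r)) +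
        ∫ s in (0 : ℝ)..t, E (t - s) (G (history r u s)) :=
      (h.semigroup.continuous_apply _).add
        (h.semigroup.continuous_convolution (continuous_comp_history h.continuous u))
    refine tendsto_nhds_unique_of_eventuallyEq (l := 𝓝[<] t)
      ((u.continuous.tendsto t).mono_left nhdsWithin_le_nhds)
      ((hc1.tendsto t).mono_left nhdsWithin_le_nhds) ?_
    filter_upwards [Ioo_mem_nhdsLT hT] with s hs
    exact (hmild s ⟨hs.1.le, hs.2⟩).2 s ⟨hs.1.le, le_rfl⟩

theorem IsAdmissible.exists_isMild (h : IsAdmissible E G) (φ : PhaseSpace r H) :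
    ∀ T, 0 ≤ T → ∃ w, IsMild E G φ T w := by
  refine real_induction ?_ (fun t ht hP => ?_) fun t ht hP => h.exists_isMild_of_forall_lt ht hP
  · refine ⟨φ.IccExtend (neg_nonpos.2 r.coe_nonneg), isMild_zero h.semigroup fun θ => ?_⟩
    exact IccExtend_of_mem _ _ θ.2
  · obtain ⟨w, hw⟩ := hP
    obtain ⟨δ, hδ, v, hv⟩ := h.exists_isMild_local (history r w t)
    obtain ⟨u, hu⟩ := hw.glue h.semigroup h.continuous ht hδ.le hv
    exact ⟨δ, hδ, fun s hs => ⟨u, hu.mono hs.2⟩⟩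

theorem IsAdmissible.exists_forall_isMild (h : IsAdmissible E G) (φ : PhaseSpace r H) :
    ∃ w, ∀ T, 0 ≤ T → IsMild E G φ T w := by
  have hcont : Continuous (commonExtension E G φ) := by
    rw [continuous_iff_continuousAt]
    intro x
    obtain ⟨w, hw⟩ := h.exists_isMild φ (max x 0 + 1) (by positivity)
    exact h.continuousAt_commonExtension (by positivity) hw (by linarith [le_max_left x 0])
  refine ⟨⟨_, hcont⟩, fun T hT => ?_⟩
  obtain ⟨w, hw⟩ := h.exists_isMild φ T hT
  refine hw.congr hT fun x hx => ?_
  change _ = commonExtension E G φ x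
  rw [h.commonExtension_eq hT hw hx.2, max_eq_left hx.1]

/-- The step to the right composes stability up to t with `local_stability` at the state u_t. -/
theorem IsAdmissible.stability (h : IsAdmissible E G) {u : C(ℝ, H)}
    (hu : ∀ T, 0 ≤ T → IsMild E G φ T u) : ∀ t, 0 ≤ t → ∀ ε > 0, ∃ γ > 0,
      ∀ (ψ : PhaseSpace r H) (w : C(ℝ, H)), ‖ψ - φ‖ ≤ γ → IsMild E G ψ t w →
        ‖history r w t - history r u t‖ ≤ ε := by
  refine real_induction (fun ε hε => ⟨ε, hε, fun ψ w hψ hw => ?_⟩) (fun t ht hP => ?_)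
    fun t ht hP ε hε => ?_
  · rwa [history_zero_eq hw.1, history_zero_eq (hu 0 le_rfl).1]
  · obtain ⟨δ, hδ, hst⟩ := h.local_stability (history r u t)
    refine ⟨δ, hδ, fun s hs ε hε => ?_⟩
    have hts : 0 ≤ s - t := sub_nonneg.2 hs.1
    have hs' : t + (s - t) = s := by ring
    have hu' : IsMild E G (history r u t) (s - t) (translate t u) :=
      (hu (t + (s - t)) (by linarith)).translate_of_add h.semigroup h.continuous ht hts
    obtain ⟨γ₁, hγ₁, H₁⟩ := hst (s - t) ⟨hts, by linarith [hs.2]⟩ _ hu' ε hε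
    obtain ⟨γ, hγ, H₂⟩ := hP γ₁ hγ₁
    refine ⟨γ, hγ, fun ψ w hψ hw => ?_⟩
    have hw' : IsMild E G (history r w t) (s - t) (translate t w) :=
      (hw.mono hs'.le).translate_of_add h.semigroup h.continuous ht hts
    have := H₁ _ _ (H₂ ψ w hψ (hw.mono hs.1)) hw' (s - t) ⟨hts, le_rfl⟩
    rwa [history_translate, history_translate, hs'] at this
  -- In the left limit, `local_stability` at states before t may reach too short a time. Instead,
  -- both solutions follow the free evolution from a time `a` near t up to ε/4, and the contraction
  -- `E` carries over the estimate at `a`.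
  · obtain ⟨M, hM, hbound⟩ := h.exists_bound ht.le (by positivity : 0 ≤ ‖φ‖ + 1)
    set a : ℝ := max 0 (t - ε / (4 * (M + 1))) with ha
    have ha0 : 0 ≤ a := le_max_left _ _
    have hat : a < t := max_lt ht (sub_lt_self _ (by positivity))
    have haε : M * (t - a) ≤ ε / 4 := by
      have h1 : t - a ≤ ε / (4 * (M + 1)) := by linarith [le_max_right 0 (t - ε / (4 * (M + 1)))]
      rw [le_div_iff₀ (by positivity)] at h1
      nlinarith
    obtain ⟨γ, hγ, H⟩ := hP a ⟨ha0, hat⟩ (ε / 4) (by positivity)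
    refine ⟨min γ 1, by positivity, fun ψ w hψ hw => ?_⟩
    have hψ1 : ‖ψ‖ ≤ ‖φ‖ + 1 := by
      have := norm_sub_norm_le ψ φ
      linarith [hψ.trans (min_le_right _ _)]
    have hMw := hbound ψ w t hψ1 le_rfl hw
    have hMu := hbound φ u t (by linarith) le_rfl (hu t ht.le)
    have hHa := H ψ w (hψ.trans (min_le_left _ _)) (hw.mono hat.le)
    have hpt : ∀ x ∈ Icc (a - r) a, ‖w x - u x‖ ≤ ε / 4 := fun x hx => by
      have := (ContinuousMap.norm_coe_le_norm (history r w a - history r u a)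
        ⟨x - a, by linarith [hx.1], by linarith [hx.2]⟩).trans hHa
      rwa [ContinuousMap.sub_apply, history_apply, history_apply, add_sub_cancel] at this
    refine (ContinuousMap.norm_le _ hε.le).2 fun θ => ?_
    rw [ContinuousMap.sub_apply, history_apply, history_apply]
    set x : ℝ := t + θ with hx
    have hxt : x ≤ t := by linarith [θ.2.2]
    rcases le_total x a with hxa | hxa
    · exact (hpt x ⟨by linarith [θ.2.1], hxa⟩).trans (by linarith)
    · have h1 := hw.norm_sub_apply_le h.semigroup h.continuous ha0 hxa hxt hMw
      have h2 := (hu t ht.le).norm_sub_apply_le h.semigroup h.continuous ha0 hxa hxt hMu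
      have h3 : ‖E (x - a) (w a - u a)‖ ≤ ε / 4 :=
        (h.semigroup.norm_apply_le _ _).trans (hpt a ⟨by linarith [r.coe_nonneg], le_rfl⟩)
      have h4 : M * (x - a) ≤ M * (t - a) := mul_le_mul_of_nonneg_left (by linarith) hM
      have h5 : w x - u x = (w x - E (x - a) (w a)) + E (x - a) (w a - u a) -
          (u x - E (x - a) (u a)) := by
        rw [map_sub]
        abel
      rw [h5]
      refine (norm_sub_le _ _).trans ?_
      linarith [norm_add_le (w x - E (x - a) (w a)) (E (x - a) (w a - u a))]

theorem IsAdmissible.exists_isDynamicalSystem (h : IsAdmissible E G) :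
    ∃ S : ℝ≥0 → PhaseSpace r H → PhaseSpace r H,
      (∀ φ u, (∀ T, 0 ≤ T → IsMild E G φ T u) → ∀ t : ℝ≥0, S t φ = history r u t) ∧
      IsDynamicalSystem S := by
  choose sol hsol using h.exists_forall_isMild
  have huniq : ∀ φ u, (∀ T, 0 ≤ T → IsMild E G φ T u) → ∀ t : ℝ≥0,
      history r (sol φ) t = history r u t := fun φ u hu t =>
    h.history_eq (hsol φ t t.2) (hu t t.2) ⟨t.2, le_rfl⟩
  refine ⟨fun t φ => history r (sol φ) t, huniq, ?_, ?_, ?_, ?_⟩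
  · funext φ
    exact history_zero_eq (hsol φ 0 le_rfl).1
  · intro t τ
    funext φ
    have htr : ∀ T, 0 ≤ T → IsMild E G (history r (sol φ) τ) T (translate τ (sol φ)) :=
      fun T hT => (hsol φ (τ + T) (add_nonneg τ.2 hT)).translate_of_add h.semigroup h.continuous
        τ.2 hT
    change history r (sol (history r (sol φ) τ)) t = history r (sol φ) (t + τ : ℝ≥0)
    rw [huniq _ _ htr, history_translate, NNReal.coe_add, add_comm]
  · exact fun φ => (continuous_history _).comp NNReal.continuous_coe
  · intro t
    rw [Metric.continuous_iff]
    intro φ ε hε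
    obtain ⟨γ, hγ, H⟩ := h.stability (hsol φ) t t.2 (ε / 2) (half_pos hε)
    refine ⟨γ, hγ, fun ψ hψ => ?_⟩
    rw [dist_eq_norm] at hψ ⊢
    exact (H ψ _ hψ.le (hsol ψ t t.2)).trans_lt (half_lt_self hε)

end MildTheory


/-! ### The state-dependent delay term is locally controlled -/

section DelayTerm

theorem exists_pos_of_continuousAt_lt {X : Type*} [SeminormedAddCommGroup X] {f : X → ℝ} {x : X}
    (hf : ContinuousAt f x) {m : ℝ} (hm : m < f x) : ∃ σ > 0, ∀ y, ‖y - x‖ ≤ σ → m < f y := by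
  obtain ⟨σ, hσ, h⟩ := Metric.eventually_nhds_iff.1 (hf.eventually_const_lt hm)
  refine ⟨σ / 2, half_pos hσ, fun y hy => h ?_⟩
  rw [dist_eq_norm]
  linarith

/-- Only one of the two points is confined to the compact set. This gives uniformity for η along a
compact curve of histories, whose neighbours range over all of C. -/
theorem exists_pos_of_isCompact {X Y : Type*} [PseudoMetricSpace X] [PseudoMetricSpace Y]
    {f : X → Y} (hf : Continuous f) {s : Set X} (hs : IsCompact s) {ε : ℝ} (hε : 0 < ε) :
    ∃ γ > 0, ∀ x ∈ s, ∀ y, dist x y < γ → dist (f x) (f y) < ε := by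
  obtain ⟨γ, hγ, h⟩ := Metric.mem_uniformity_dist.1
    (hs.uniformContinuousAt_of_continuousAt f (fun x _ => hf.continuousAt)
      (Metric.dist_mem_uniformity hε))
  exact ⟨γ, hγ, fun x hx y hxy => h hxy hx⟩

variable {H : Type*} [NormedAddCommGroup H] {r : ℝ≥0}

/-- The curve that agrees with `w` up to time `0` and stays constant afterwards. -/
noncomputable def freeze (w : C(ℝ, H)) : C(ℝ, H) where
  toFun t := w (min t 0)
  continuous_toFun := by fun_prop

theorem freeze_apply (w : C(ℝ, H)) (t : ℝ) : freeze w t = w (min t 0) := rfl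

variable {B : H → H} {LB : ℝ≥0} {Θu Θl η : PhaseSpace r H → Icc (0 : ℝ) r}
  {w v : C(ℝ, H)} {φ : PhaseSpace r H}

theorem history_negPt (w : C(ℝ, H)) (s : ℝ) (a : Icc (0 : ℝ) r) :
    history r w s (negPt a) = w (s - a) := by
  rw [history_apply, sub_eq_add_neg]
  rfl

theorem continuous_negPt : Continuous (negPt : Icc (0 : ℝ) r → Icc (-(r : ℝ)) 0) :=
  continuous_subtype_val.neg.subtype_mk _

theorem continuous_delayTerm (hB : LipschitzWith LB B) (hη : Continuous η) :
    Continuous (delayTerm B η) :=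
  hB.continuous.comp (continuous_eval.comp (continuous_id.prodMk (continuous_negPt.comp hη)))

theorem norm_delayTerm_le (hB : LipschitzWith LB B) (χ : PhaseSpace r H) :
    ‖delayTerm B η χ‖ ≤ ‖B 0‖ + LB * ‖χ‖ := by
  have h1 := hB.norm_sub_le (χ (negPt (η χ))) 0
  rw [sub_zero] at h1
  have h2 := mul_le_mul_of_nonneg_left (χ.norm_coe_le_norm (negPt (η χ))) LB.coe_nonneg
  have h3 := norm_sub_norm_le (B (χ (negPt (η χ)))) (B 0)
  change ‖B (χ (negPt (η χ)))‖ ≤ _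
  linarith

/-- The intermediate `p` is meant as the value of `v` at the delayed time of `w`: it separates the
change of curve from the change of delay. -/
theorem norm_delayTerm_sub_le (hB : LipschitzWith LB B) (s : ℝ) {p x y : H} {C ε : ℝ}
    (hx : w (s - η (history r w s)) = x) (hy : v (s - η (history r v s)) = y)
    (hxp : ‖x - p‖ ≤ C) (hyp : ‖p - y‖ ≤ ε) :
    ‖delayTerm B η (history r w s) - delayTerm B η (history r v s)‖ ≤ LB * (C + ε) := by
  refine (hB.norm_sub_le _ _).trans (mul_le_mul_of_nonneg_left ?_ LB.coe_nonneg)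
  rw [history_negPt, history_negPt, hx, hy, ← sub_add_sub_cancel x p y]
  exact (norm_add_le _ _).trans (add_le_add hxp hyp)

/-- As long as `s ≤ Θˡ(w_s)`, the delay `η(w_s)` does not depend on the values of `w` at positive
times. -/
theorem IgnoresOutside.apply_history_freeze (hH : IgnoresOutside Θu Θl η) {s : ℝ}
    (hs : s ≤ Θl (history r w s)) : η (history r (freeze w) s) = η (history r w s) := by
  refine hH _ _ fun θ hθ => ?_
  rw [history_apply, history_apply, freeze_apply, min_eq_left]
  linarith [hθ.2]

theorem isLocallyControlled_delayTerm (hB : LipschitzWith LB B) (hΘl : Continuous Θl) {L : ℝ≥0}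
    (hZ : ∀ φ ∈ zeroSet Θl, LipschitzWith L φ) (hη : Continuous η)
    (hH : IgnoresOutside Θu Θl η) (hη_pos : ∀ φ ∈ zeroSet Θl, 0 < (η φ : ℝ))
    {ω : ℝ} (hω : 0 < ω) {Lη : ℝ}
    (hη_lip : ∀ φ ∈ nbhd ω (zeroSet Θl), ∀ ψ ∈ nbhd ω (zeroSet Θl),
      |(η φ : ℝ) - (η ψ : ℝ)| ≤ Lη * ‖φ - ψ‖) :
    IsLocallyControlled (delayTerm B η) := by
  intro φ
  have hLB := LB.coe_nonneg
  have hΘl' : Continuous fun χ => (Θl χ : ℝ) := continuous_subtype_val.comp hΘl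
  have hη' : Continuous fun χ => (η χ : ℝ) := continuous_subtype_val.comp hη
  have hsmall : ∀ ε > 0, (LB : ℝ) * (ε / (LB + 1)) ≤ ε := fun ε hε => by
    rw [← mul_div_assoc, div_le_iff₀ (by positivity)]
    nlinarith
  by_cases hφ : (Θl φ : ℝ) = 0
  · have hpos : 0 < (η φ : ℝ) := hη_pos φ hφ
    obtain ⟨σ, hσ, hm⟩ := exists_pos_of_continuousAt_lt hη'.continuousAt (half_lt_self hpos)
    -- Delays near φ exceed η(φ)/2, so up to this time the delayed argument lies in [-r, 0]. The
    -- absolute value is needed since no sign of `Lη` is assumed.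
    refine ⟨min σ ω, by positivity, (η φ : ℝ) / 2, half_pos hpos, LB * (L * |Lη|), by positivity,
      ?_⟩
    intro T hT u hu hu' ε hε
    refine ⟨ε / (LB + 1), by positivity, fun w hw hw' s hs => ?_⟩
    have hpast : ∀ χ, ‖χ - φ‖ ≤ min σ ω → s - η χ ∈ Icc (-(r : ℝ)) 0 := fun χ hχ =>
      ⟨by linarith [(η χ).2.2, hs.1], by linarith [hs.2, hm χ (hχ.trans (min_le_left _ _))]⟩
    have hnb : ∀ χ, ‖χ - φ‖ ≤ min σ ω → χ ∈ nbhd ω (zeroSet Θl) := fun χ hχ =>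
      ⟨φ, hφ, hχ.trans (min_le_right _ _)⟩
    have hp := hpast _ (hw' s hs)
    have hq := hpast _ (hu' s hs)
    have hη2 := hη_lip _ (hnb _ (hw' s hs)) _ (hnb _ (hu' s hs))
    have hφpq : ‖φ ⟨_, hp⟩ - φ ⟨_, hq⟩‖ ≤ L * |Lη| * ‖history r w s - history r u s‖ := by
      have h1 := (hZ φ hφ).dist_le_mul ⟨_, hp⟩ ⟨_, hq⟩
      rw [dist_eq_norm, Subtype.dist_eq, Real.dist_eq] at h1
      have h2 : s - η (history r w s) - (s - η (history r u s)) =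
          -((η (history r w s) : ℝ) - η (history r u s)) := by ring
      dsimp only at h1
      rw [h2, abs_neg] at h1
      refine h1.trans ?_
      rw [mul_assoc]
      refine mul_le_mul_of_nonneg_left (hη2.trans ?_) L.coe_nonneg
      exact mul_le_mul_of_nonneg_right (le_abs_self _) (norm_nonneg _)
    refine (norm_delayTerm_sub_le hB s rfl (hu ⟨_, hq⟩) (hw ⟨_, hp⟩) hφpq).trans ?_
    linarith [hsmall ε hε]
  · have hpos : 0 < (Θl φ : ℝ) := lt_of_le_of_ne (Θl φ).2.1 (Ne.symm hφ)
    obtain ⟨σ, hσ, hm⟩ := exists_pos_of_continuousAt_lt hΘl'.continuousAt (half_lt_self hpos)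
    refine ⟨σ, hσ, (Θl φ : ℝ) / 2, half_pos hpos, LB, hLB, ?_⟩
    intro T hT u hu hu' ε hε
    -- The margin `ρ` for the delays comes from the continuity of `u`, and `γ` from that of η along
    -- the frozen histories of `u`; so `γ` may depend on `u`, but not on `w`.
    obtain ⟨ρ, hρ, hucont⟩ := exists_pos_of_isCompact u.continuous
      (isCompact_Icc (a := -(r : ℝ)) (b := T)) (by positivity : 0 < ε / (LB + 1))
    obtain ⟨γ, hγ, hηcont⟩ := exists_pos_of_isCompact hη'
      ((isCompact_Icc (a := (0 : ℝ)) (b := T)).image (continuous_history (r := r) (freeze u))) hρ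
    refine ⟨γ / 2, half_pos hγ, fun w hw hw' s hs => ?_⟩
    have hfr : ∀ x : C(ℝ, H), (∀ s ∈ Icc 0 T, ‖history r x s - φ‖ ≤ σ) →
        η (history r (freeze x) s) = η (history r x s) := fun x hx =>
      hH.apply_history_freeze (by linarith [hm _ (hx s hs), hs.2])
    -- Frozen curves differ only through their initial functions, so the delays are close however
    -- far `w` and `u` have separated after time 0.
    have hdist : dist (history r (freeze u) s) (history r (freeze w) s) < γ := by
      rw [dist_comm, dist_eq_norm]
      refine lt_of_le_of_lt (norm_history_sub_le hs.1 (fun θ => ?_) fun x hx => ?_)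
        (half_lt_self hγ)
      · rw [freeze_apply, freeze_apply, min_eq_left θ.2.2, hu]
        exact hw θ
      · rw [freeze_apply, freeze_apply, min_eq_right hx.1]
        have h1 := hw (zeroPt r)
        rwa [← hu (zeroPt r), zeroPt_coe] at h1
    have hηd := hηcont _ (mem_image_of_mem _ hs) _ hdist
    rw [hfr u hu', hfr w hw'] at hηd
    have hud := hucont (s - η (history r u s))
      ⟨by linarith [(η (history r u s)).2.2, hs.1], by linarith [(η (history r u s)).2.1, hs.2]⟩
      (s - η (history r w s)) (by rwa [dist_sub_left])
    rw [dist_comm, dist_eq_norm] at hud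
    have h1 := ContinuousMap.norm_coe_le_norm (history r w s - history r u s)
      (negPt (η (history r w s)))
    rw [ContinuousMap.sub_apply, history_negPt, history_negPt] at h1
    refine (norm_delayTerm_sub_le hB s rfl rfl h1 hud.le).trans ?_
    linarith [hsmall ε hε]

variable [NormedSpace ℝ H]

theorem IsLocallyControlled.sub_smul_zeroPt {F : PhaseSpace r H → H} (hF : IsLocallyControlled F)
    {d : ℝ} (hd : 0 ≤ d) : IsLocallyControlled fun χ => F χ - d • χ (zeroPt r) := by
  intro φ
  obtain ⟨σ, hσ, δ, hδ, K, hK, h⟩ := hF φ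
  refine ⟨σ, hσ, δ, hδ, K + d, by positivity, fun T hT u hu hu' ε hε => ?_⟩
  obtain ⟨γ, hγ, h2⟩ := h T hT u hu hu' ε hε
  refine ⟨γ, hγ, fun w hw hw' s hs => ?_⟩
  have h3 := h2 w hw hw' s hs
  have h4 : ‖d • (history r w s - history r u s) (zeroPt r)‖ ≤
      d * ‖history r w s - history r u s‖ := by
    rw [norm_smul, Real.norm_of_nonneg hd]
    exact mul_le_mul_of_nonneg_left (ContinuousMap.norm_coe_le_norm _ _) hd
  rw [sub_sub_sub_comm, ← smul_sub]
  refine (norm_sub_le _ _).trans ?_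
  rw [ContinuousMap.sub_apply] at h4
  linarith

theorem isAdmissible_delayTerm {E : ℝ → H →L[ℝ] H} (hE : IsContractionSemigroup E)
    (hB : LipschitzWith LB B) (hη : Continuous η) (hc : IsLocallyControlled (delayTerm B η))
    {d : ℝ} (hd : 0 ≤ d) :
    IsAdmissible E fun χ : PhaseSpace r H => delayTerm B η χ - d • χ (zeroPt r) where
  semigroup := hE
  continuous := (continuous_delayTerm hB hη).sub
    ((continuous_eval_const (zeroPt r)).const_smul d)
  growth := by
    refine ⟨‖B 0‖, LB + d, norm_nonneg _, by positivity, fun χ => ?_⟩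
    have h1 := norm_delayTerm_le (η := η) hB χ
    have h2 : ‖d • χ (zeroPt r)‖ ≤ d * ‖χ‖ := by
      rw [norm_smul, Real.norm_of_nonneg hd]
      exact mul_le_mul_of_nonneg_left (χ.norm_coe_le_norm _) hd
    refine (norm_sub_le _ _).trans ?_
    linarith
  controlled := hc.sub_smul_zeroPt hd

end DelayTerm

/-! ### Transfer to the stated notions of solution -/

section Extension

variable {H : Type*} [NormedAddCommGroup H] {r : ℝ≥0}

theorem extendIci_apply (u : C(Ici (-(r : ℝ)), H)) {x : ℝ} (hx : -(r : ℝ) ≤ x) :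
    extendIci u x = u ⟨x, hx⟩ := by
  change u _ = u _
  congr
  exact max_eq_right hx

theorem extendIcc_apply {T : ℝ≥0} (u : C(Icc (-(r : ℝ)) T, H)) {x : ℝ}
    (hx : x ∈ Icc (-(r : ℝ)) T) : extendIcc u x = u ⟨x, hx⟩ :=
  IccExtend_of_mem _ _ hx

end Extension

section Equivalence

variable {H : Type*} [NormedAddCommGroup H] [InnerProductSpace ℝ H] [CompleteSpace H] {r : ℝ≥0}

theorem satisfiesIVP_iff_isMild {A : H →ₗ.[ℝ] H} {E : ℝ → H →L[ℝ] H}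
    (hEA : ∀ t, 0 ≤ t → ∀ x, E t x = expNeg A t x) {d : ℝ} {B : H → H}
    {η : PhaseSpace r H → Icc (0 : ℝ) r} {φ : PhaseSpace r H} {T : ℝ≥0} {w : C(ℝ, H)} :
    SatisfiesIVP A d B η φ T w ↔
      IsMild E (fun χ : PhaseSpace r H => delayTerm B η χ - d • χ (zeroPt r)) φ T w := by
  refine and_congr_right fun _ => forall₂_congr fun t ht => ?_
  rw [hEA t ht.1]
  have : ∫ s in (0 : ℝ)..t, expNeg A (t - s) (delayTerm B η (history r w s) - d • w s) =
      ∫ s in (0 : ℝ)..t, E (t - s) (delayTerm B η (history r w s) -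
        d • history r w s (zeroPt r)) := by
    refine intervalIntegral.integral_congr fun s hs => ?_
    rw [uIcc_of_le ht.1] at hs
    rw [hEA _ (sub_nonneg.2 hs.2), history_zeroPt]
  rw [this]

end Equivalence

end DelayParabolic

open DelayParabolic
theorem theorem2 {n : ℕ} (Ω : Set (EuclideanSpace ℝ (Fin n)))
    (_hΩ_open : IsOpen Ω) (_hΩ_bdd : Bornology.IsBounded Ω)
    -- the densely defined, self-adjoint, nonnegative operator with compact resolvent
    (A : L2 Ω →ₗ.[ℝ] L2 Ω)
    (hA_dense : Dense (A.domain : Set (L2 Ω)))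
    (hA_self : IsSelfAdjoint A)
    (hA_nonneg : ∀ x : A.domain, 0 ≤ inner ℝ (A x) (x : L2 Ω))
    (hA_res : HasCompactResolvent A)
    (d : ℝ) (hd : 0 ≤ d)
    (r : ℝ≥0) (hr : 0 < r)
    (B : L2 Ω → L2 Ω) (LB : ℝ≥0) (hB : LipschitzWith LB B)
    (Θu Θl η : PhaseSpace r (L2 Ω) → Icc (0 : ℝ) r)
    (hΘ : ∀ φ, Θl φ ≤ Θu φ)
    (hΘu : Continuous Θu) (hΘl : Continuous Θl)
    (L : ℝ≥0) (hZ : ∀ φ ∈ zeroSet Θl, LipschitzWith L φ)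
    (hη : Continuous η) (hH : IgnoresOutside Θu Θl η)
    (hη_pos : ∀ φ ∈ zeroSet Θl, 0 < (η φ : ℝ))
    (ω : ℝ) (hω : 0 < ω) (Lη : ℝ)
    (hη_lip : ∀ φ ∈ nbhd ω (zeroSet Θl),
      ∀ ψ ∈ nbhd ω (zeroSet Θl),
        |(η φ : ℝ) - (η ψ : ℝ)| ≤ Lη * ‖φ - ψ‖) :
    -- existence and uniqueness, globally and on every bounded interval
    (∀ φ, ∃! u : C(Ici (-(r : ℝ)), L2 Ω),
      IsGlobalMildSolution A d B η φ u) ∧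
    (∀ φ, ∀ T : ℝ≥0, ∃! u : C(Icc (-(r : ℝ)) T, L2 Ω),
      IsMildSolutionOn A d B η φ T u) ∧
    -- the evolution operators `S_t φ = u_t` form a dynamical system
    (∃ S : ℝ≥0 → PhaseSpace r (L2 Ω) →
        PhaseSpace r (L2 Ω),
      (∀ φ, ∀ u : C(Ici (-(r : ℝ)), L2 Ω),
        IsGlobalMildSolution A d B η φ u →
          ∀ t : ℝ≥0, S t φ = history r (extendIci u) t) ∧
      IsDynamicalSystem S) := by
  obtain ⟨E, hE, hEA⟩ := exists_isContractionSemigroup_expNeg hA_dense hA_self hA_nonneg hA_res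
  have h := isAdmissible_delayTerm hE hB hη
    (isLocallyControlled_delayTerm hB hΘl hZ hη hH hη_pos hω hη_lip) hd
  refine ⟨fun φ => ?_, fun φ T => ?_, ?_⟩
  · obtain ⟨w, hw⟩ := h.exists_forall_isMild φ
    let u : C(Ici (-(r : ℝ)), L2 Ω) := ⟨fun x => w x, by fun_prop⟩
    refine ⟨u, fun T => (satisfiesIVP_iff_isMild hEA).2 ((hw T T.2).congr T.2 fun x hx => ?_),
      fun v hv => ?_⟩
    · exact (extendIci_apply u hx.1).symm
    · ext1 x
      -- As x may be negative, its positive part serves as the horizon for uniqueness.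
      have hx : (x : ℝ) ≤ Real.toNNReal x := Real.le_coe_toNNReal x
      have := h.eqOn ((satisfiesIVP_iff_isMild hEA).1 (hv (Real.toNNReal x)))
        (hw _ (NNReal.coe_nonneg _)) x ⟨x.2, hx⟩
      rwa [extendIci_apply v x.2] at this
  · obtain ⟨w, hw⟩ := h.exists_isMild φ T T.2
    let u : C(Icc (-(r : ℝ)) T, L2 Ω) := ⟨fun x => w x, by fun_prop⟩
    refine ⟨u, (satisfiesIVP_iff_isMild hEA).2 (hw.congr T.2 fun x hx => ?_), fun v hv => ?_⟩
    · exact (extendIcc_apply u hx).symm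
    · ext1 x
      have := h.eqOn ((satisfiesIVP_iff_isMild hEA).1 hv) hw x x.2
      rwa [extendIcc_apply v x.2] at this
  · obtain ⟨S, hS, hS'⟩ := h.exists_isDynamicalSystem
    refine ⟨S, fun φ u hu t => hS φ _ (fun T hT => ?_) t, hS'⟩
    exact (satisfiesIVP_iff_isMild hEA).1 (hu ⟨T, hT⟩)
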